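/- Let $n\ge 0$ and let $\mathcal H\subset\mathbb R^{n+1}$ be a smooth connected (nonempty) hypersurface, i.e. a connected smooth $n$-manifold with an injective smooth immersion $\iota:\mathcal H\to\mathbb R^{n+1}$ (in particular, every connected embedded hypersurface is allowed); we write $x$ for $\iota(x)$. Assume: 1. $\mathcal H$ is centroaffine: for every $p\in\mathcal H$ the position vector $p$ does not lie in the tangent space $T_p\mathcal H\subset\mathbb R^{n+1}$. 2. $\mathcal H$ is hyperbolic: the symmetric bilinear form $g$ on $\mathcal H$ determined by the Gauss equation $\tilde\nabla_X Y=\nabla_X Y+g(X,Y)\,\xi$ for all smooth vector fields $X,Y$ on $\mathcal H$ is positive definite at every point. Here $\tilde\nabla$ is the canonical flat connection of $\mathbb R^{n+1}$, $\nabla_XY$ is tangent to $\mathcal H$, and $\xi_p=p$ is the position vector field. 3. $\mathcal H$ is Euclidean complete: $\mathcal H$ is complete with respect to the Riemannian distance of the metric induced on $\mathcal H$ by the Euclidean scalar product of $\mathbb R^{n+1}$. Then the cone $U=\mathbb R^{>0}\cdot\mathcal H=\{\lambda x:\lambda>0,\ x\in\mathcal H\}$ is an open and convex subset of $\mathbb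 R^{n+1}$, and the map $$\phi:\mathbb R^{>0}\times\mathcal H\to U,\qquad (\lambda,x)\mapsto\lambda x,$$ is a ($C^\infty$) diffeomorphism. -/

import Mathlib

open scoped Manifold ContDiff ENNReal Pointwise

noncomputable section

variable {n : ℕ} {M : Type*} [TopologicalSpace M] [ChartedSpace (EuclideanSpace ℝ (Fin n)) M]

/-- The differential of `ι : M → ℝⁿ⁺¹` at `p`, with values in the vector space `ℝⁿ⁺¹`. -/
def hypersurfaceDifferential (ι : M → EuclideanSpace ℝ (Fin (n + 1))) (p : M) :
    TangentSpace (𝓡 n) p →L[ℝ] EuclideanSpace ℝ (Fin (n + 1)) :=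
  mfderiv (𝓡 n) 𝓘(ℝ, EuclideanSpace ℝ (Fin (n + 1))) ι p

/-- `ι` is centroaffine: the position vector `ι p` is transversal to `dι (T_p M)` for all `p`. -/
def IsCentroaffine (ι : M → EuclideanSpace ℝ (Fin (n + 1))) : Prop :=
  ∀ p : M, ι p ∉ Set.range (hypersurfaceDifferential ι p)

/-- A vector field `Y` on the manifold `M` is smooth. -/
def IsSmoothVectorField [IsManifold (𝓡 n) ∞ M]
    (Y : ∀ p : M, TangentSpace (𝓡 n) p) : Prop :=
  ContMDiff (𝓡 n) (𝓡 n).tangent ∞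
    (fun p => (⟨p, Y p⟩ : TangentBundle (𝓡 n) M))

/-- The derivative at `p` in the direction `v`, with respect to the canonical flat connection of
`ℝⁿ⁺¹`, of the vector field `dι Y : M → ℝⁿ⁺¹` along `ι`. -/
def flatDerivative (ι : M → EuclideanSpace ℝ (Fin (n + 1)))
    (Y : ∀ p : M, TangentSpace (𝓡 n) p) (p : M) (v : TangentSpace (𝓡 n) p) :
    EuclideanSpace ℝ (Fin (n + 1)) :=
  hypersurfaceDifferential (fun q => hypersurfaceDifferential ι q (Y q)) p v

/-- `g` is the centroaffine metric of `ι`, that is, the bilinear form in the Gauss equation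
`D_X (dι Y) = dι (∇_X Y) + g(X, Y) ξ`, where `ξ = ι` is the position vector field. The tangent
vector `u` below is the value of `∇_X Y` at `p`. -/
def IsCentroaffineMetric [IsManifold (𝓡 n) ∞ M]
    (ι : M → EuclideanSpace ℝ (Fin (n + 1)))
    (g : ∀ p : M, TangentSpace (𝓡 n) p →L[ℝ] TangentSpace (𝓡 n) p →L[ℝ] ℝ) : Prop :=
  ∀ Y : (∀ p : M, TangentSpace (𝓡 n) p), IsSmoothVectorField Y →
    ∀ (p : M) (v : TangentSpace (𝓡 n) p), ∃ u : TangentSpace (𝓡 n) p,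
      flatDerivative ι Y p v = hypersurfaceDifferential ι p u + g p v (Y p) • ι p

/-- `ι` is hyperbolic: its centroaffine metric is positive definite. -/
def IsHyperbolic [IsManifold (𝓡 n) ∞ M]
    (ι : M → EuclideanSpace ℝ (Fin (n + 1))) : Prop :=
  ∃ g : (∀ p : M, TangentSpace (𝓡 n) p →L[ℝ] TangentSpace (𝓡 n) p →L[ℝ] ℝ),
    IsCentroaffineMetric ι g ∧ ∀ (p : M) (v : TangentSpace (𝓡 n) p), v ≠ 0 → 0 < g p v v

/-- The Riemannian distance on `M` of the metric induced by the Euclidean scalar product: the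
infimum of the Euclidean lengths of `C¹` paths in `M`, a tangent vector `v` having the
length `‖dι v‖`. -/
def inducedEDist (ι : M → EuclideanSpace ℝ (Fin (n + 1))) (x y : M) : ℝ≥0∞ :=
  letI : ∀ p : M, ENorm (TangentSpace (𝓡 n) p) :=
    fun p => ⟨fun v => ‖hypersurfaceDifferential ι p v‖ₑ⟩
  Manifold.riemannianEDist (𝓡 n) x y

/-- `ι` is Euclidean complete: every Cauchy sequence for the induced Riemannian distance
converges. -/
def IsEuclideanComplete (ι : M → EuclideanSpace ℝ (Fin (n + 1))) : Prop :=
  ∀ u : ℕ → M,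
    (∀ ε : ℝ≥0∞, 0 < ε → ∃ N, ∀ i ≥ N, ∀ j ≥ N, inducedEDist ι (u i) (u j) < ε) →
    ∃ x : M, Filter.Tendsto (fun i => inducedEDist ι (u i) x) Filter.atTop (nhds 0)

/-- The cone `ℝ^{>0} · ι(M)`. -/
def positiveCone (ι : M → EuclideanSpace ℝ (Fin (n + 1))) :
    Set (EuclideanSpace ℝ (Fin (n + 1))) :=
  Set.Ioi (0 : ℝ) • Set.range ι

/-- The positive real numbers, as an open submanifold of `ℝ`. -/
def positiveReals : TopologicalSpace.Opens ℝ := ⟨Set.Ioi 0, isOpen_Ioi⟩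

end

/-! Let `φ (r, x) = r • ι x` be the cone map. Transversality of the position vector makes `φ` a
local diffeomorphism, so everything reduces to showing that `φ` is injective with convex image.

The radial coordinate `h (r, x) = r` controls lifts of segments through `φ`. If `H • y = a + t • v`
with `y` a curve in the hypersurface, differentiating twice and taking the component along `y` gives
`H'' + H * g(w, w) = 0`, with `w` the velocity in `M`. By hyperbolicity `H` is concave
(`concaveAlongLifts_radial`). If moreover `H` stays above some `m > 0` on a bounded half-open
interval, then `y` has finite length, because its speed is bounded by a constant plus a multiple of
`|H'|`, and a bounded concave `H` has finite variation near the open end. Completeness then makes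
the lift converge (`liftsConverge_radial`).

A continuity argument concludes (`visible_of_concaveAlongLifts`). Call two points visible if they
lie in an open set mapped injectively onto a convex set. The points visible from `a` form an open
set. It is closed: if `b` is a limit of visible points, concavity bounds `h` from below by `min (h
a) (h b)` along the partial lift of the segment from `φ a` to `φ b`, so the lift cannot escape
before reaching the end. By connectedness any two points are visible from each other, which is
injectivity and convexity at once. -/

/-! ### Convex sheets of a local homeomorphism and the visibility argument -/

section Sheets

open Set Filter Topology

variable {N E : Type*} [TopologicalSpace N] [NormedAddCommGroup E] [NormedSpace ℝ E]

/-- An open set on which `φ` is injective, with convex image. -/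
def IsConvexSheet (φ : N → E) (W : Set N) : Prop :=
  IsOpen W ∧ InjOn φ W ∧ Convex ℝ (φ '' W)

/-- Two points are visible from each other if they lie on a common convex sheet. -/
def Visible (φ : N → E) (a b : N) : Prop :=
  ∃ W, IsConvexSheet φ W ∧ a ∈ W ∧ b ∈ W

theorem IsConvexSheet.exists_section {φ : N → E} (hφ : IsLocalHomeomorph φ) {W : Set N}
    (hW : IsConvexSheet φ W) (a : N) :
    ∃ s : E → N, ContinuousOn s (φ '' W) ∧ (∀ z ∈ φ '' W, s z ∈ W ∧ φ (s z) = z) ∧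
      ∀ w ∈ W, s (φ w) = w := by
  classical
  have : Nonempty N := ⟨a⟩
  refine ⟨Function.invFunOn φ W, ?_, fun z hz => ?_, fun w hw => ?_⟩
  · rintro _ ⟨w, hw, rfl⟩
    intro O hO
    rw [hW.2.1.leftInvOn_invFunOn hw] at hO
    have h1 : φ '' (O ∩ W) ∈ 𝓝 (φ w) :=
      hφ.isOpenMap.image_mem_nhds (inter_mem hO (hW.1.mem_nhds hw))
    refine mem_map.2 (mem_of_superset (mem_nhdsWithin_of_mem_nhds h1) ?_)
    rintro _ ⟨x, ⟨hxO, hxW⟩, rfl⟩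
    simpa [hW.2.1.leftInvOn_invFunOn hxW] using hxO
  · exact ⟨Function.invFunOn_mem hz, Function.invFunOn_eq hz⟩
  · exact hW.2.1.leftInvOn_invFunOn hw

/-- The sections over the two images agree at `φ a`. The overlap of the images is convex, hence
connected, so uniqueness of lifts makes them agree on all of it. -/
theorem IsConvexSheet.eq_of_map_eq [T2Space N] {φ : N → E} (hφ : IsLocalHomeomorph φ)
    {W W' : Set N} (hW : IsConvexSheet φ W) (hW' : IsConvexSheet φ W') {a b b' : N}
    (ha : a ∈ W) (ha' : a ∈ W') (hb : b ∈ W) (hb' : b' ∈ W') (h : φ b = φ b') : b = b' := by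
  obtain ⟨s, hs, hsW, hsi⟩ := hW.exists_section hφ a
  obtain ⟨s', hs', hsW', hsi'⟩ := hW'.exists_section hφ a
  have hpre : IsPreconnected (φ '' W ∩ φ '' W') := (hW.2.2.inter hW'.2.2).isPreconnected
  have key : EqOn s s' (φ '' W ∩ φ '' W') :=
    (T2Space.isSeparatedMap φ).eqOn_of_comp_eqOn hφ.isLocallyInjective hpre
      (hs.mono inter_subset_left) (hs'.mono inter_subset_right)
      (fun z hz => by simp [(hsW z hz.1).2, (hsW' z hz.2).2])
      (a := φ a) ⟨mem_image_of_mem _ ha, mem_image_of_mem _ ha'⟩ (by rw [hsi a ha, hsi' a ha'])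
  have := key (x := φ b) ⟨mem_image_of_mem _ hb, h ▸ mem_image_of_mem _ hb'⟩
  rwa [hsi b hb, h, hsi' b' hb'] at this

theorem Visible.eq_of_map_eq [T2Space N] {φ : N → E} (hφ : IsLocalHomeomorph φ) {a b b' : N}
    (h : Visible φ a b) (h' : Visible φ a b') (hbb : φ b = φ b') : b = b' := by
  obtain ⟨W, hW, ha, hb⟩ := h
  obtain ⟨W', hW', ha', hb'⟩ := h'
  exact hW.eq_of_map_eq hφ hW' ha ha' hb hb' hbb

/-- Injectivity on a compact set spreads to an open neighbourhood, whose open image contains a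
thickening of the compact image; thickenings of convex sets are convex. -/
theorem exists_isConvexSheet_of_isCompact {φ : N → E} (hφ : IsLocalHomeomorph φ)
    {K : Set N} (hK : IsCompact K) (hinj : InjOn φ K) (hconv : Convex ℝ (φ '' K)) :
    ∃ W, IsConvexSheet φ W ∧ K ⊆ W := by
  obtain ⟨t, ht, hKt, hti⟩ := hinj.exists_isOpen_superset hK
    (fun x _ => hφ.continuous.continuousAt) fun x _ => by
      obtain ⟨e, hxe, rfl⟩ := hφ x
      exact ⟨e.source, e.open_source.mem_nhds hxe, e.injOn⟩
  obtain ⟨δ, hδ, hsub⟩ := (hK.image hφ.continuous).exists_thickening_subset_open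
    (hφ.isOpenMap t ht) (image_mono hKt)
  refine ⟨t ∩ φ ⁻¹' (Metric.thickening δ (φ '' K)),
    ⟨ht.inter (Metric.isOpen_thickening.preimage hφ.continuous),
      hti.mono inter_subset_left, ?_⟩, fun x hx => ⟨hKt hx, ?_⟩⟩
  · rw [image_inter_preimage, inter_eq_right.2 hsub]
    exact hconv.thickening δ
  · exact Metric.self_subset_thickening hδ _ (mem_image_of_mem _ hx)

theorem Visible.refl {φ : N → E} (hφ : IsLocalHomeomorph φ) (a : N) : Visible φ a a := by
  obtain ⟨W, hW, h⟩ := exists_isConvexSheet_of_isCompact hφ (isCompact_singleton (x := a))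
    (injOn_singleton _ _) (by simp)
  exact ⟨W, hW, h rfl, h rfl⟩

/-- The end points of a continuous lift of a nondegenerate segment are visible from each other. -/
theorem visible_of_lift {φ : N → E} (hφ : IsLocalHomeomorph φ) {a₀ v : E} (hv : v ≠ 0) {T : ℝ}
    (hT : 0 ≤ T) {σ : ℝ → N} (hσ : ContinuousOn σ (Icc 0 T))
    (hlift : ∀ t ∈ Icc 0 T, φ (σ t) = a₀ + t • v) : Visible φ (σ 0) (σ T) := by
  obtain ⟨W, hW, h⟩ := exists_isConvexSheet_of_isCompact hφ (isCompact_Icc.image_of_continuousOn hσ)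
    (by
      rintro _ ⟨t, ht, rfl⟩ _ ⟨t', ht', rfl⟩ h
      rw [hlift t ht, hlift t' ht', add_right_inj] at h
      rw [smul_left_injective ℝ hv h])
    (by
      have : φ '' (σ '' Icc 0 T) = AffineMap.lineMap (k := ℝ) a₀ (a₀ + v) '' Icc 0 T := by
        rw [image_image]
        refine image_congr fun t ht => ?_
        rw [hlift t ht, AffineMap.lineMap_apply]
        simp [add_comm]
      rw [this]
      exact (convex_Icc 0 T).affine_image _)
  exact ⟨W, hW, h (mem_image_of_mem _ ⟨le_rfl, hT⟩), h (mem_image_of_mem _ ⟨hT, le_rfl⟩)⟩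

/-- Along a convex sheet, the segment between two points lifts. -/
theorem IsConvexSheet.exists_lift {φ : N → E} (hφ : IsLocalHomeomorph φ) {W : Set N}
    (hW : IsConvexSheet φ W) {a b : N} (ha : a ∈ W) (hb : b ∈ W) :
    ∃ σ : ℝ → N, ContinuousOn σ (Icc 0 1) ∧ (∀ t ∈ Icc (0 : ℝ) 1, σ t ∈ W) ∧
      (∀ t ∈ Icc (0 : ℝ) 1, φ (σ t) = φ a + t • (φ b - φ a)) ∧ σ 0 = a ∧ σ 1 = b := by
  obtain ⟨s, hs, hsW, hsi⟩ := hW.exists_section hφ a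
  have hmem : ∀ t ∈ Icc (0 : ℝ) 1, φ a + t • (φ b - φ a) ∈ φ '' W := fun t ht =>
    hW.2.2.add_smul_sub_mem (mem_image_of_mem _ ha) (mem_image_of_mem _ hb) ht
  refine ⟨fun t => s (φ a + t • (φ b - φ a)), hs.comp (by fun_prop) hmem,
    fun t ht => (hsW _ (hmem t ht)).1, fun t ht => (hsW _ (hmem t ht)).2, ?_, ?_⟩
  · simp [hsi a ha]
  · simp [hsi b hb]

/-- `h` is concave along every lift of a segment. -/
def ConcaveAlongLifts (φ : N → E) (h : N → ℝ) : Prop :=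
  ∀ (a₀ v : E) (σ : ℝ → N), ContinuousOn σ (Icc 0 1) →
    (∀ t ∈ Icc (0 : ℝ) 1, φ (σ t) = a₀ + t • v) → ConcaveOn ℝ (Icc 0 1) (h ∘ σ)

/-- Half-open lifts of segments along which `h` is bounded away from zero have a limit. -/
def LiftsConverge (φ : N → E) (h : N → ℝ) : Prop :=
  ∀ (a₀ v : E) (T : ℝ) (σ : ℝ → N) (m : ℝ), 0 < T → ContinuousOn σ (Ico 0 T) →
    (∀ t ∈ Ico 0 T, φ (σ t) = a₀ + t • v) → 0 < m → (∀ t ∈ Ico 0 T, m ≤ h (σ t)) →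
    ∃ b, Tendsto σ (𝓝[<] T) (𝓝 b)

theorem injective_of_visible {φ : N → E} (h : ∀ a b, Visible φ a b) : Function.Injective φ :=
  fun a b hab => let ⟨_, hW, ha, hb⟩ := h a b; hW.2.1 ha hb hab

theorem convex_range_of_visible {φ : N → E} (h : ∀ a b, Visible φ a b) :
    Convex ℝ (range φ) := by
  rw [convex_iff_segment_subset]
  rintro _ ⟨a, rfl⟩ _ ⟨b, rfl⟩
  obtain ⟨W, hW, ha, hb⟩ := h a b
  exact (hW.2.2.segment_subset (mem_image_of_mem _ ha) (mem_image_of_mem _ hb)).trans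
    (image_subset_range _ _)

variable [T2Space N]

/-- Concavity is not available towards `b` itself, since `b` is not yet known to be visible. It
holds on lifted segments from `a` to visible points `x` near `b`; their points at time `t` tend to
`p` as `x` tends to `b`. -/
theorem exists_lower_bound_of_mem_closure {φ : N → E} (hφ : IsLocalHomeomorph φ) {h : N → ℝ}
    (hcont : Continuous h) (hconc : ConcaveAlongLifts φ h) {a b p : N}
    (hb : b ∈ closure {b | Visible φ a b}) {t : ℝ} (ht : t ∈ Icc (0 : ℝ) 1)
    (hp : Visible φ a p) (hpt : φ p = φ a + t • (φ b - φ a)) :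
    (1 - t) * h a + t * h b ≤ h p := by
  obtain ⟨W, hW, haW, hpW⟩ := hp
  obtain ⟨s, hs, hsW, hsi⟩ := hW.exists_section hφ a
  have hWo : IsOpen (φ '' W) := hφ.isOpenMap W hW.1
  have hc : Continuous fun x : N => φ a + t • (φ x - φ a) := by
    have := hφ.continuous
    fun_prop
  have hmem : ∀ᶠ x in 𝓝[{b | Visible φ a b}] b, φ a + t • (φ x - φ a) ∈ φ '' W :=
    nhdsWithin_le_nhds (hc.continuousAt.eventually_mem
      (hWo.mem_nhds (hpt ▸ mem_image_of_mem φ hpW)))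
  have hne : (𝓝[{b | Visible φ a b}] b).NeBot := mem_closure_iff_nhdsWithin_neBot.1 hb
  have hs' : ContinuousAt s (φ a + t • (φ b - φ a)) := by
    rw [← hpt]
    exact hs.continuousAt (hWo.mem_nhds (mem_image_of_mem φ hpW))
  have hlim : Tendsto (fun x => h (s (φ a + t • (φ x - φ a)))) (𝓝[{b | Visible φ a b}] b)
      (𝓝 (h p)) := by
    have h1 : Tendsto (fun x => h (s (φ a + t • (φ x - φ a)))) (𝓝 b)
        (𝓝 (h (s (φ a + t • (φ b - φ a))))) :=
      (hcont.continuousAt.comp (ContinuousAt.comp (f := fun x : N => φ a + t • (φ x - φ a))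
        hs' hc.continuousAt)).tendsto
    rw [← hpt, hsi p hpW] at h1
    exact h1.mono_left nhdsWithin_le_nhds
  have hlim2 : Tendsto (fun x => (1 - t) * h a + t * h x) (𝓝[{b | Visible φ a b}] b)
      (𝓝 ((1 - t) * h a + t * h b)) :=
    ((by fun_prop : Continuous fun x => (1 - t) * h a + t * h x).tendsto b).mono_left
      nhdsWithin_le_nhds
  refine le_of_tendsto_of_tendsto hlim2 hlim ?_
  filter_upwards [hmem, self_mem_nhdsWithin] with x hx hxv
  obtain ⟨W', hW', haW', hxW'⟩ := hxv
  obtain ⟨σ, hσ, hσW, hσl, hσ0, hσ1⟩ := hW'.exists_lift hφ haW' hxW'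
  have h2 := (hconc _ _ σ hσ hσl).2 (left_mem_Icc.2 zero_le_one)
    (right_mem_Icc.2 zero_le_one) (by linarith [ht.2] : 0 ≤ 1 - t) ht.1 (by ring)
  have h3 : σ t = s (φ a + t • (φ x - φ a)) :=
    hW'.eq_of_map_eq hφ hW haW' haW (hσW t ht) (hsW _ hx).1 (by rw [hσl t ht, (hsW _ hx).2])
  simpa [hσ0, hσ1, h3] using h2

/-- Lifting of a segment whose end point is a limit of visible points. -/
theorem exists_visible_of_mem_closure {φ : N → E} (hφ : IsLocalHomeomorph φ) {h : N → ℝ}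
    (hcont : Continuous h) (hpos : ∀ x, 0 < h x) (hconc : ConcaveAlongLifts φ h)
    (hlim : LiftsConverge φ h) {a b : N} (hb : b ∈ closure {b | Visible φ a b}) :
    ∃ b', Visible φ a b' ∧ φ b' = φ b := by
  classical
  by_cases hv : φ b - φ a = 0
  · exact ⟨a, Visible.refl hφ a, (sub_eq_zero.1 hv).symm⟩
  set v := φ b - φ a with hvdef
  -- The times reached by visible lifts. `J` is not cut down to `[0, 1]`, so it is open in `ℝ`; if
  -- it misses `1`, its supremum is not in it, and convergence of the lift at the supremum is
  -- contradictory.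
  let J : Set ℝ := {t | ∃ p, Visible φ a p ∧ φ p = φ a + t • v}
  have hJ0 : (0 : ℝ) ∈ J := ⟨a, Visible.refl hφ a, by simp⟩
  -- The choice is harmless: a visible point is determined by its image, so on `J` this agrees
  -- locally with continuous sections.
  let σ : ℝ → N := fun t => if ht : t ∈ J then ht.choose else a
  have hσ : ∀ t ∈ J, Visible φ a (σ t) ∧ φ (σ t) = φ a + t • v := fun t ht => by
    simp only [σ, dif_pos ht]
    exact ht.choose_spec
  have hσ0 : σ 0 = a :=
    (hσ 0 hJ0).1.eq_of_map_eq hφ (Visible.refl hφ a) (by rw [(hσ 0 hJ0).2]; simp)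
  have hJseg : ∀ t ∈ J, ∀ r ∈ Icc 0 t, r ∈ J := by
    rintro t ⟨p, ⟨W, hW, haW, hpW⟩, hp⟩ r ⟨hr0, hrt⟩
    rcases hr0.eq_or_lt with rfl | hr
    · exact hJ0
    have ht : 0 < t := hr.trans_le hrt
    obtain ⟨q, hq, hq'⟩ := hW.2.2.add_smul_sub_mem (mem_image_of_mem _ haW)
      (mem_image_of_mem _ hpW) (t := r / t) ⟨by positivity, (div_le_one ht).2 hrt⟩
    refine ⟨q, ⟨W, hW, haW, hq⟩, ?_⟩
    rw [hq', hp, add_sub_cancel_left, smul_smul, div_mul_cancel₀ _ ht.ne']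
  have hJc : ∀ t ∈ J, J ∈ 𝓝 t ∧ ContinuousAt σ t := by
    rintro t ⟨p, ⟨W, hW, haW, hpW⟩, hp⟩
    obtain ⟨s, hs, hsW, hsi⟩ := hW.exists_section hφ a
    have hWo : IsOpen (φ '' W) := hφ.isOpenMap W hW.1
    have hc : Continuous fun r : ℝ => φ a + r • v := by fun_prop
    have hmem : ∀ᶠ r in 𝓝 t, φ a + r • v ∈ φ '' W :=
      hc.continuousAt.eventually_mem (hWo.mem_nhds (hp ▸ mem_image_of_mem φ hpW))
    have hvis : ∀ r : ℝ, φ a + r • v ∈ φ '' W → Visible φ a (s (φ a + r • v)) ∧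
        φ (s (φ a + r • v)) = φ a + r • v :=
      fun r hr => ⟨⟨W, hW, haW, (hsW _ hr).1⟩, (hsW _ hr).2⟩
    refine ⟨hmem.mono fun r hr => ⟨_, hvis r hr⟩, ?_⟩
    have heq : (fun r => s (φ a + r • v)) =ᶠ[𝓝 t] σ := hmem.mono fun r hr => by
      have hrJ : r ∈ J := ⟨_, hvis r hr⟩
      exact (hvis r hr).1.eq_of_map_eq hφ (hσ r hrJ).1 (by rw [(hvis r hr).2, (hσ r hrJ).2])
    refine ContinuousAt.congr ?_ heq
    exact ContinuousAt.comp (f := fun r : ℝ => φ a + r • v)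
      (hs.continuousAt (hWo.mem_nhds (hp ▸ mem_image_of_mem φ hpW))) hc.continuousAt
  by_cases h1 : (1 : ℝ) ∈ J
  · obtain ⟨p, hp, hp'⟩ := h1
    exact ⟨p, hp, by rw [hp', hvdef]; simp⟩
  exfalso
  have hJbdd : BddAbove J := ⟨1, fun t ht => by
    by_contra! hlt
    exact h1 (hJseg t ht 1 ⟨zero_le_one, hlt.le⟩)⟩
  set T := sSup J with hTdef
  have hTJ : T ∉ J := fun hT => by
    obtain ⟨r, hr, hrJ⟩ := ((eventually_mem_nhdsWithin.and
      (nhdsWithin_le_nhds (hJc T hT).1)).exists : ∃ r, r ∈ Ioi T ∧ r ∈ J)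
    exact absurd (le_csSup hJbdd hrJ) (not_le.2 hr)
  have hIco : ∀ t ∈ Ico 0 T, t ∈ J := fun t ht => by
    obtain ⟨r, hr, htr⟩ := exists_lt_of_lt_csSup ⟨0, hJ0⟩ ht.2
    exact hJseg r hr t ⟨ht.1, htr.le⟩
  have hT0 : 0 < T := lt_of_le_of_ne (le_csSup hJbdd hJ0) fun h0 => hTJ (h0 ▸ hJ0)
  have hT1 : T ≤ 1 := csSup_le ⟨0, hJ0⟩ fun t ht => by
    by_contra! hlt
    exact h1 (hJseg t ht 1 ⟨zero_le_one, hlt.le⟩)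
  have hσc : ContinuousOn σ (Ico 0 T) := fun t ht => (hJc t (hIco t ht)).2.continuousWithinAt
  obtain ⟨c, hc⟩ := hlim (φ a) v T σ (min (h a) (h b)) hT0 hσc (fun t ht => (hσ t (hIco t ht)).2)
    (lt_min (hpos a) (hpos b)) fun t ht => by
      have := exists_lower_bound_of_mem_closure hφ hcont hconc hb
        ⟨ht.1, ht.2.le.trans hT1⟩ (hσ t (hIco t ht)).1 (hσ t (hIco t ht)).2
      have h2 := mul_le_mul_of_nonneg_left (min_le_left (h a) (h b))
        (by linarith [ht.2] : 0 ≤ 1 - t)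
      have h3 := mul_le_mul_of_nonneg_left (min_le_right (h a) (h b)) ht.1
      linarith
  let τ : ℝ → N := Function.update σ T c
  have hτ : ∀ t, t ≠ T → τ t = σ t := fun t ht => Function.update_of_ne ht _ _
  have hτT : τ T = c := Function.update_self _ _ _
  have hφc : φ c = φ a + T • v := by
    refine tendsto_nhds_unique ((hφ.continuous.tendsto c).comp hc) ?_
    have h4 : Tendsto (fun t : ℝ => φ a + t • v) (𝓝[<] T) (𝓝 (φ a + T • v)) :=
      ((by fun_prop : Continuous fun t : ℝ => φ a + t • v).tendsto T).mono_left nhdsWithin_le_nhds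
    refine h4.congr' ?_
    filter_upwards [Ico_mem_nhdsLT hT0] with t ht
    exact (hσ t (hIco t ht)).2.symm
  have hτc : ContinuousOn τ (Icc 0 T) := by
    intro t ht
    rcases ht.2.eq_or_lt with rfl | hlt
    · rw [← Ico_insert_right hT0.le, continuousWithinAt_insert_self]
      rw [ContinuousWithinAt, hτT]
      refine Tendsto.congr' ?_ (hc.mono_left (nhdsWithin_mono _ fun x hx => hx.2))
      filter_upwards [self_mem_nhdsWithin] with x hx
      exact (hτ x hx.2.ne).symm
    · have h5 : ContinuousAt τ t := by
        refine (hJc t (hIco t ⟨ht.1, hlt⟩)).2.congr ?_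
        filter_upwards [eventually_ne_nhds hlt.ne] with x hx
        exact (hτ x hx).symm
      exact h5.continuousWithinAt
  have hvis := visible_of_lift hφ hv hT0.le hτc (a₀ := φ a) fun t ht => by
    rcases ht.2.eq_or_lt with rfl | hlt
    · rw [hτT, hφc]
    · rw [hτ t hlt.ne, (hσ t (hIco t ⟨ht.1, hlt⟩)).2]
  rw [hτ 0 hT0.ne, hσ0, hτT] at hvis
  exact hTJ ⟨c, hvis, hφc⟩

theorem visible_of_concaveAlongLifts [PreconnectedSpace N] {φ : N → E} (hφ : IsLocalHomeomorph φ)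
    {h : N → ℝ} (hcont : Continuous h) (hpos : ∀ x, 0 < h x) (hconc : ConcaveAlongLifts φ h)
    (hlim : LiftsConverge φ h) (a b : N) : Visible φ a b := by
  have hopen : IsOpen {b | Visible φ a b} := by
    refine isOpen_iff_mem_nhds.2 fun p ⟨W, hW, ha, hp⟩ => ?_
    exact mem_of_superset (hW.1.mem_nhds hp) fun q hq => ⟨W, hW, ha, hq⟩
  have hclosed : IsClosed {b | Visible φ a b} := by
    refine closure_subset_iff_isClosed.1 fun b hb => ?_
    obtain ⟨b', ⟨W, hW, haW, hbW⟩, hφb⟩ :=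
      exists_visible_of_mem_closure hφ hcont hpos hconc hlim hb
    obtain ⟨s, hs, hsW, hsi⟩ := hW.exists_section hφ a
    have hWo : φ '' W ∈ 𝓝 (φ b) :=
      (hφ.isOpenMap W hW.1).mem_nhds (hφb ▸ mem_image_of_mem φ hbW)
    have hne : (𝓝[{b | Visible φ a b}] b).NeBot := mem_closure_iff_nhdsWithin_neBot.1 hb
    -- Near `b`, the map `s ∘ φ` fixes visible points. Along them it tends both to `b'` and to `b`,
    -- so Hausdorffness gives `b = b'`.
    have h1 : Tendsto (fun x => s (φ x)) (𝓝 b) (𝓝 b') := by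
      have : Tendsto (fun x => s (φ x)) (𝓝 b) (𝓝 (s (φ b))) :=
        (ContinuousAt.comp (f := φ) (hs.continuousAt hWo) hφ.continuous.continuousAt).tendsto
      rwa [← hφb, hsi b' hbW] at this
    have h2 : (fun x => s (φ x)) =ᶠ[𝓝[{b | Visible φ a b}] b] id := by
      filter_upwards [self_mem_nhdsWithin,
        nhdsWithin_le_nhds (hφ.continuous.continuousAt.eventually_mem hWo)] with x hx hxW
      exact Visible.eq_of_map_eq hφ ⟨W, hW, haW, (hsW _ hxW).1⟩ hx (hsW _ hxW).2
    have h3 : b = b' := tendsto_nhds_unique (tendsto_id.mono_left nhdsWithin_le_nhds)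
      (Tendsto.congr' h2 (h1.mono_left nhdsWithin_le_nhds))
    exact h3 ▸ ⟨W, hW, haW, hbW⟩
  have huniv := IsClopen.eq_univ ⟨hclosed, hopen⟩ ⟨a, Visible.refl hφ a⟩
  exact eq_univ_iff_forall.1 huniv b

end Sheets

/-! ### Injectivity of the differential of an immersion -/

section Immersions

open Set Filter Topology

/-- The differential of an immersion is injective. -/
theorem Manifold.IsImmersionAt.mfderiv_injective
    {E F M N : Type*} [NormedAddCommGroup E] [NormedSpace ℝ E]
    [NormedAddCommGroup F] [NormedSpace ℝ F] [TopologicalSpace M] [ChartedSpace E M]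
    [TopologicalSpace N] [ChartedSpace F N] {k : WithTop ℕ∞} (hk : k ≠ 0)
    [IsManifold 𝓘(ℝ, E) k M] [IsManifold 𝓘(ℝ, F) k N]
    {f : M → N} {x : M} (h : Manifold.IsImmersionAt 𝓘(ℝ, E) 𝓘(ℝ, F) k f x) :
    Function.Injective (mfderiv 𝓘(ℝ, E) 𝓘(ℝ, F) f x) := by
  have hd : h.domChart.MDifferentiable 𝓘(ℝ, E) 𝓘(ℝ, E) :=
    ⟨(contMDiffOn_of_mem_maximalAtlas h.domChart_mem_maximalAtlas).mdifferentiableOn hk,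
      (contMDiffOn_symm_of_mem_maximalAtlas h.domChart_mem_maximalAtlas).mdifferentiableOn hk⟩
  have hc : MDifferentiableAt 𝓘(ℝ, F) 𝓘(ℝ, F) h.codChart (f x) :=
    (contMDiffAt_of_mem_maximalAtlas h.codChart_mem_maximalAtlas
      h.mem_codChart_source).mdifferentiableAt hk
  have hf : MDifferentiableAt 𝓘(ℝ, E) 𝓘(ℝ, F) f x := h.contMDiffAt.mdifferentiableAt hk
  -- In adapted charts the immersion is `u ↦ (u, 0)`; `A` projects back to the first factor, giving
  -- a differentiable left inverse.
  let A : F → E := fun z => (h.equiv.symm z).1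
  have hA : MDifferentiableAt 𝓘(ℝ, F) 𝓘(ℝ, E) A (h.codChart (f x)) := by
    refine DifferentiableAt.mdifferentiableAt ?_
    fun_prop
  have heq : A ∘ h.codChart ∘ f =ᶠ[𝓝 x] h.domChart := by
    filter_upwards [h.domChart.open_source.mem_nhds h.mem_domChart_source] with y hy
    have hy' : h.domChart y ∈ (h.domChart.extend 𝓘(ℝ, E)).target := by
      simpa using h.domChart.map_source hy
    have := h.writtenInCharts hy'
    simp only [Function.comp_apply, OpenPartialHomeomorph.extend_coe,
      OpenPartialHomeomorph.extend_coe_symm, modelWithCornersSelf_coe,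
      modelWithCornersSelf_coe_symm, id, h.domChart.left_inv hy] at this
    simp [A, this]
  have h1 := (heq.mfderiv_eq (I := 𝓘(ℝ, E)) (I' := 𝓘(ℝ, E))).symm
  rw [mfderiv_comp x hA (hc.comp x hf), mfderiv_comp x hc hf] at h1
  have h2 := hd.mfderiv_injective h.mem_domChart_source
  intro v w hvw
  apply h2
  rw [h1]
  exact congrArg (fun z => mfderiv 𝓘(ℝ, F) 𝓘(ℝ, E) A _ (mfderiv 𝓘(ℝ, F) 𝓘(ℝ, F) h.codChart _ z)) hvw

end Immersions

/-! ### The inverse function theorem on manifolds -/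

section LocalDiffeo

open Set Filter Topology

theorem MDifferentiableAt.mfderiv_eq_fderiv
    {E F H N : Type*} [NormedAddCommGroup E] [NormedSpace ℝ E]
    [NormedAddCommGroup F] [NormedSpace ℝ F] [TopologicalSpace H]
    {I : ModelWithCorners ℝ E H} [I.Boundaryless] [TopologicalSpace N] [ChartedSpace H N]
    {f : N → F} {p : N} (hf : MDifferentiableAt I 𝓘(ℝ, F) f p) :
    mfderiv I 𝓘(ℝ, F) f p = fderiv ℝ (f ∘ (extChartAt I p).symm) (extChartAt I p p) := by
  have h : fderivWithin ℝ (f ∘ (extChartAt I p).symm) (range I) (extChartAt I p p) =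
      fderiv ℝ (f ∘ (extChartAt I p).symm) (extChartAt I p p) := by
    rw [I.range_eq_univ, fderivWithin_univ]
  exact hf.mfderiv.trans h

theorem isLocalDiffeomorphAt_of_mfderiv_bijective
    {E F H N : Type*} [NormedAddCommGroup E] [NormedSpace ℝ E] [CompleteSpace E]
    [NormedAddCommGroup F] [NormedSpace ℝ F] [CompleteSpace F] [TopologicalSpace H]
    {I : ModelWithCorners ℝ E H} [I.Boundaryless] [TopologicalSpace N] [ChartedSpace H N]
    [IsManifold I ∞ N] {f : N → F} (hf : ContMDiff I 𝓘(ℝ, F) ∞ f) {p : N}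
    (hp : Function.Bijective (mfderiv I 𝓘(ℝ, F) f p)) :
    IsLocalDiffeomorphAt I 𝓘(ℝ, F) ∞ f p := by
  set ψ := extChartAt I p with hψ
  let g : E → F := f ∘ ψ.symm
  have hT : IsOpen ψ.target := isOpen_extChartAt_target p
  have hpT : ψ p ∈ ψ.target := mem_extChartAt_target p
  have hg : ContDiffOn ℝ ∞ g ψ.target :=
    (hf.comp_contMDiffOn (contMDiffOn_extChartAt_symm p)).contDiffOn
  have hgat : ∀ u ∈ ψ.target, ContDiffAt ℝ ∞ g u := fun u hu => hg.contDiffAt (hT.mem_nhds hu)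
  have hd : mfderiv I 𝓘(ℝ, F) f p = fderiv ℝ g (ψ p) :=
    (hf.mdifferentiableAt (by simp)).mfderiv_eq_fderiv
  rw [hd] at hp
  let L : E ≃L[ℝ] F := ContinuousLinearEquiv.ofBijective (fderiv ℝ g (ψ p))
    (LinearMap.ker_eq_bot.2 hp.1) (LinearMap.range_eq_top.2 hp.2)
  have hL : HasFDerivAt g (L : E →L[ℝ] F) (ψ p) := by
    have : (L : E →L[ℝ] F) = fderiv ℝ g (ψ p) := by ext; rfl
    rw [this]
    exact ((hgat _ hpT).differentiableAt (by simp)).hasFDerivAt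
  let e := (hgat _ hpT).toOpenPartialHomeomorph g hL (by simp)
  have hpe : ψ p ∈ e.source := ContDiffAt.mem_toOpenPartialHomeomorph_source _ hL (by simp)
  have hcont : ContinuousOn (fderiv ℝ g) ψ.target :=
    hg.continuousOn_fderiv_of_isOpen hT (by simp)
  -- Smoothness of the inverse on a whole neighbourhood needs an invertible derivative at each of
  -- its points, an open condition.
  let O : Set E := ψ.target ∩ fderiv ℝ g ⁻¹' range ((↑) : (E ≃L[ℝ] F) → (E →L[ℝ] F))
  have hO : IsOpen O := hcont.isOpen_inter_preimage hT ContinuousLinearEquiv.isOpen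
  have hpO : ψ p ∈ O := ⟨hpT, L, by ext; rfl⟩
  let e' := e.restrOpen O hO
  have he' : e'.source = e.source ∩ O := e.restrOpen_source O hO
  have hes : ContDiffOn ℝ ∞ e'.symm e'.target := by
    intro z hz
    have hz' : e'.symm z ∈ e.source ∩ O := he' ▸ e'.map_target hz
    obtain ⟨L', hL'⟩ := hz'.2.2
    refine (e'.contDiffAt_symm hz (f₀' := L') ?_ (hgat _ hz'.2.1)).contDiffWithinAt
    rw [hL']
    exact ((hgat _ hz'.2.1).differentiableAt (by simp)).hasFDerivAt
  let Ψ : PartialDiffeomorph I 𝓘(ℝ, E) N E ∞ :=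
    { toPartialEquiv := ψ
      open_source := isOpen_extChartAt_source p
      open_target := hT
      contMDiffOn_toFun := by
        have := contMDiffOn_extChartAt (I := I) (n := ∞) (x := p)
        rwa [← extChartAt_source I] at this
      contMDiffOn_invFun := contMDiffOn_extChartAt_symm p }
  let G : PartialDiffeomorph 𝓘(ℝ, E) 𝓘(ℝ, F) E F ∞ :=
    { toPartialEquiv := e'.toPartialEquiv
      open_source := e'.open_source
      open_target := e'.open_target
      contMDiffOn_toFun := by
        refine ContDiffOn.contMDiffOn (hg.mono ?_)
        rw [he']
        exact fun u hu => hu.2.1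
      contMDiffOn_invFun := hes.contMDiffOn }
  have h1 : IsLocalDiffeomorphAt I 𝓘(ℝ, E) ∞ ψ p :=
    ⟨Ψ, mem_extChartAt_source p, fun _ _ => rfl⟩
  have h2 : IsLocalDiffeomorphAt 𝓘(ℝ, E) 𝓘(ℝ, F) ∞ g (ψ p) :=
    ⟨G, by change ψ p ∈ e'.source; rw [he']; exact ⟨hpe, hpO⟩, fun _ _ => rfl⟩
  obtain ⟨Θ, hΘ, hΘe⟩ := h1.comp 𝓘(ℝ, F) F h2
  let V : Set N := Θ.source ∩ ψ.source
  have hV : IsOpen V := Θ.open_source.inter (isOpen_extChartAt_source p)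
  have hgf : ∀ q ∈ V, Θ q = f q := fun q hq => by
    rw [← hΘe hq.1]
    simp [g, ψ.left_inv hq.2]
  let T := Θ.toOpenPartialHomeomorph.restrOpen V hV
  have hT : T.source = V := by
    rw [OpenPartialHomeomorph.restrOpen_source]
    exact inter_eq_right.2 inter_subset_left
  refine ⟨{ toPartialEquiv := T.toPartialEquiv
            open_source := T.open_source
            open_target := T.open_target
            contMDiffOn_toFun := Θ.contMDiffOn_toFun.mono (by rw [hT]; exact inter_subset_left)
            contMDiffOn_invFun := Θ.contMDiffOn_invFun.mono fun z hz => hz.1 }, ?_, ?_⟩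
  · change p ∈ T.source
    rw [hT]
    exact ⟨hΘ, mem_extChartAt_source p⟩
  · intro q hq
    change q ∈ T.source at hq
    rw [hT] at hq
    exact (hgf q hq).symm

end LocalDiffeo

/-! ### The cone map is a local diffeomorphism -/

section ConeMap

open Set Filter Topology

/-- The map `(r, x) ↦ r • ι x`. -/
def coneMap {n : ℕ} {M : Type*} (ι : M → EuclideanSpace ℝ (Fin (n + 1))) (p : positiveReals × M) :
    EuclideanSpace ℝ (Fin (n + 1)) :=
  (p.1 : ℝ) • ι p.2

theorem range_coneMap {n : ℕ} {M : Type*} (ι : M → EuclideanSpace ℝ (Fin (n + 1))) :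
    range (coneMap ι) = positiveCone ι := by
  ext z
  constructor
  · rintro ⟨⟨r, x⟩, rfl⟩
    exact ⟨r, r.2, ι x, ⟨x, rfl⟩, rfl⟩
  · rintro ⟨r, hr, _, ⟨x, rfl⟩, rfl⟩
    exact ⟨(⟨r, hr⟩, x), rfl⟩

variable {n : ℕ} {M : Type*} [TopologicalSpace M] [ChartedSpace (EuclideanSpace ℝ (Fin n)) M]

theorem contMDiff_coneMap [IsManifold (𝓡 n) ∞ M] {ι : M → EuclideanSpace ℝ (Fin (n + 1))}
    (hι : ContMDiff (𝓡 n) (𝓡 (n + 1)) ∞ ι) :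
    ContMDiff (𝓘(ℝ, ℝ).prod (𝓡 n)) (𝓡 (n + 1)) ∞ (coneMap ι) := by
  have h1 : ContMDiff (𝓘(ℝ, ℝ).prod (𝓡 n)) 𝓘(ℝ, ℝ) ∞
      (fun p : positiveReals × M => (p.1 : ℝ)) :=
    contMDiff_subtype_val.comp contMDiff_fst
  exact h1.smul (hι.comp contMDiff_snd)

/-- In a chart the differential is `(a, w) ↦ r • dι w + a • ι x`. Transversality forces `a = 0` on
its kernel, the immersion property then forces `w = 0`, and the dimensions agree. -/
theorem mfderiv_coneMap_bijective [IsManifold (𝓡 n) ∞ M]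
    {ι : M → EuclideanSpace ℝ (Fin (n + 1))}
    (himm : Manifold.IsImmersion (𝓡 n) (𝓡 (n + 1)) ∞ ι) (hcent : IsCentroaffine ι)
    (p : positiveReals × M) :
    Function.Bijective (mfderiv (𝓘(ℝ, ℝ).prod (𝓡 n)) (𝓡 (n + 1)) (coneMap ι) p) := by
  obtain ⟨r, x⟩ := p
  have hι := himm.contMDiff
  set ψ := extChartAt (𝓡 n) x
  let F : EuclideanSpace ℝ (Fin n) → EuclideanSpace ℝ (Fin (n + 1)) := ι ∘ ψ.symm
  have hF : DifferentiableAt ℝ F (ψ x) :=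
    (((hι.comp_contMDiffOn (contMDiffOn_extChartAt_symm x)).contDiffOn.contDiffAt
      ((isOpen_extChartAt_target x).mem_nhds (mem_extChartAt_target x)))).differentiableAt (by simp)
  have hd : mfderiv (𝓡 n) (𝓡 (n + 1)) ι x = fderiv ℝ F (ψ x) :=
    (hι.mdifferentiableAt (by simp)).mfderiv_eq_fderiv
  have hinj : Function.Injective (fderiv ℝ F (ψ x)) := by
    rw [← hd]
    exact (himm.isImmersionAt x).mfderiv_injective (by simp)
  have hnot : ι x ∉ range (fderiv ℝ F (ψ x)) := by
    rw [← hd]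
    exact hcent x
  let g : ℝ × EuclideanSpace ℝ (Fin n) → EuclideanSpace ℝ (Fin (n + 1)) := fun z => z.1 • F z.2
  let D : ℝ × EuclideanSpace ℝ (Fin n) →L[ℝ] EuclideanSpace ℝ (Fin (n + 1)) :=
    (r : ℝ) • (fderiv ℝ F (ψ x)).comp (ContinuousLinearMap.snd ℝ _ _)
      + (ContinuousLinearMap.fst ℝ ℝ (EuclideanSpace ℝ (Fin n))).smulRight (F (ψ x))
  have hD : HasFDerivAt g D ((r : ℝ), ψ x) := by
    have h2 : HasFDerivAt (fun z : ℝ × EuclideanSpace ℝ (Fin n) => F z.2)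
        ((fderiv ℝ F (ψ x)).comp (ContinuousLinearMap.snd ℝ _ _)) ((r : ℝ), ψ x) :=
      HasFDerivAt.comp (g := F) ((r : ℝ), ψ x) hF.hasFDerivAt hasFDerivAt_snd
    have h1 : HasFDerivAt (fun z : ℝ × EuclideanSpace ℝ (Fin n) => z.1)
        (ContinuousLinearMap.fst ℝ ℝ (EuclideanSpace ℝ (Fin n))) ((r : ℝ), ψ x) := hasFDerivAt_fst
    exact h1.smul h2
  have hm : mfderiv (𝓘(ℝ, ℝ).prod (𝓡 n)) (𝓡 (n + 1)) (coneMap ι) (r, x) =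
      fderiv ℝ g ((r : ℝ), ψ x) := by
    refine ((contMDiff_coneMap hι).mdifferentiableAt (by simp)).mfderiv_eq_fderiv.trans ?_
    refine Filter.EventuallyEq.fderiv_eq ?_
    have : ∀ᶠ z : ℝ × EuclideanSpace ℝ (Fin n) in 𝓝 ((r : ℝ), ψ x),
        z.1 ∈ (extChartAt 𝓘(ℝ, ℝ) r).target :=
      continuous_fst.continuousAt.eventually_mem (extChartAt_target_mem_nhds (I := 𝓘(ℝ, ℝ)) r)
    filter_upwards [this] with z hz
    have h1 : (((extChartAt 𝓘(ℝ, ℝ) r).symm z.1 : positiveReals) : ℝ) = z.1 :=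
      (extChartAt 𝓘(ℝ, ℝ) r).right_inv hz
    change (((extChartAt 𝓘(ℝ, ℝ) r).symm z.1 : positiveReals) : ℝ) • ι (ψ.symm z.2) = _
    rw [h1]
    rfl
  rw [hm, hD.fderiv]
  have hinj' : Function.Injective D := by
    rw [injective_iff_map_eq_zero]
    rintro ⟨a, w⟩ h
    have hFx : F (ψ x) = ι x := by simp [F, ψ]
    simp only [D, add_apply, smul_apply,
      ContinuousLinearMap.comp_apply, ContinuousLinearMap.coe_snd', hFx,
      ContinuousLinearMap.smulRight_apply, ContinuousLinearMap.coe_fst'] at h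
    have ha : a = 0 := by
      by_contra ha
      apply hnot
      refine ⟨-(a⁻¹ * r : ℝ) • w, ?_⟩
      rw [map_smul]
      have h' := eq_neg_of_add_eq_zero_left h
      rw [neg_smul, mul_smul, h', smul_neg, neg_neg, inv_smul_smul₀ ha]
    subst ha
    have hr : (r : ℝ) ≠ 0 := (show (0 : ℝ) < r from r.2).ne'
    simp only [zero_smul, add_zero, smul_eq_zero, hr, false_or] at h
    rw [(injective_iff_map_eq_zero _).1 hinj w h]
    rfl
  refine ⟨hinj', ?_⟩
  refine (LinearMap.injective_iff_surjective_of_finrank_eq_finrank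
    (f := (D : ℝ × EuclideanSpace ℝ (Fin n) →ₗ[ℝ] EuclideanSpace ℝ (Fin (n + 1)))) ?_).1 hinj'
  simp [add_comm]

theorem isLocalDiffeomorph_coneMap [IsManifold (𝓡 n) ∞ M]
    {ι : M → EuclideanSpace ℝ (Fin (n + 1))}
    (himm : Manifold.IsImmersion (𝓡 n) (𝓡 (n + 1)) ∞ ι) (hcent : IsCentroaffine ι) :
    IsLocalDiffeomorph (𝓘(ℝ, ℝ).prod (𝓡 n)) (𝓡 (n + 1)) ∞ (coneMap ι) := fun p =>
  isLocalDiffeomorphAt_of_mfderiv_bijective (contMDiff_coneMap himm.contMDiff)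
    (mfderiv_coneMap_bijective himm hcent p)

end ConeMap

/-! ### The Gauss equation along curves and concavity of the radial coordinate -/

section GaussEquation

open Set Filter Topology Bundle

variable {n : ℕ} {M : Type*} [TopologicalSpace M] [ChartedSpace (EuclideanSpace ℝ (Fin n)) M]

theorem hypersurfaceDifferential_eq_fderiv {ι : M → EuclideanSpace ℝ (Fin (n + 1))} {p : M}
    (hι : MDifferentiableAt (𝓡 n) (𝓡 (n + 1)) ι p) :
    hypersurfaceDifferential ι p =
      fderiv ℝ (ι ∘ (extChartAt (𝓡 n) p).symm) (extChartAt (𝓡 n) p p) :=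
  hι.mfderiv_eq_fderiv

theorem deriv_comp_eq_hypersurfaceDifferential
    {ι : M → EuclideanSpace ℝ (Fin (n + 1))} {X : ℝ → M} {t₀ : ℝ}
    (hι : MDifferentiableAt (𝓡 n) (𝓡 (n + 1)) ι (X t₀))
    (hX : MDifferentiableAt 𝓘(ℝ, ℝ) (𝓡 n) X t₀) :
    deriv (ι ∘ X) t₀ = hypersurfaceDifferential ι (X t₀) (mfderiv 𝓘(ℝ, ℝ) (𝓡 n) X t₀ 1) := by
  have h := mfderiv_comp t₀ hι hX
  rw [mfderiv_eq_fderiv] at h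
  rw [← fderiv_apply_one_eq_deriv]
  exact congrArg (fun A => A (1 : ℝ)) h

variable [IsManifold (𝓡 n) ∞ M]

/-- The vector field which is constant in the chart at `p`, equal to `w`, cut off by a bump
function. -/
theorem exists_smoothVectorField_const [T2Space M] (p : M) (w : EuclideanSpace ℝ (Fin n)) :
    ∃ Y : ∀ q : M, TangentSpace (𝓡 n) q, IsSmoothVectorField Y ∧ Y p = w ∧
      ∀ᶠ q in 𝓝 p, mfderiv (𝓡 n) 𝓘(ℝ, EuclideanSpace ℝ (Fin n)) (extChartAt (𝓡 n) p) q (Y q)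
        = w := by
  let e := trivializationAt (EuclideanSpace ℝ (Fin n)) (TangentSpace (𝓡 n) : M → Type _) p
  let s : ∀ q : M, TangentSpace (𝓡 n) q := fun q => e.symmL ℝ q w
  have hs : ContMDiffOn (𝓡 n) ((𝓡 n).prod 𝓘(ℝ, EuclideanSpace ℝ (Fin n))) ∞
      (fun q => TotalSpace.mk' (EuclideanSpace ℝ (Fin n)) q (s q)) e.baseSet := by
    rw [e.contMDiffOn_section_baseSet_iff]
    refine (contMDiffOn_const (c := w)).congr fun q hq => ?_
    simp only [s]
    rw [e.symmL_apply hq]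
    rw [e.apply_mk_symm hq]
  let f : SmoothBumpFunction (𝓡 n) p := Classical.arbitrary _
  have hbase : e.baseSet = (chartAt (EuclideanSpace ℝ (Fin n)) p).source :=
    TangentBundle.trivializationAt_baseSet p
  have hev : ∀ᶠ q in 𝓝 p,
      mfderiv (𝓡 n) 𝓘(ℝ, EuclideanSpace ℝ (Fin n)) (extChartAt (𝓡 n) p) q (((f : M → ℝ) • s) q) = w := by
    filter_upwards [f.eventuallyEq_one, chart_source_mem_nhds (EuclideanSpace ℝ (Fin n)) p]
      with q hq hqs
    have h1 : ((f : M → ℝ) • s) q = s q := by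
      simp only [Pi.smul_apply']
      rw [hq]
      simp
    rw [h1, ← TangentBundle.continuousLinearMapAt_trivializationAt hqs]
    exact e.continuousLinearMapAt_symmL (hbase ▸ hqs) w
  refine ⟨(f : M → ℝ) • s, ContMDiffOn.smul_section_of_tsupport f.contMDiff.contMDiffOn e.open_baseSet
    (hbase ▸ f.tsupport_subset_chartAt_source) hs, ?_, hev⟩
  have := hev.self_of_nhds
  rw [mfderiv_extChartAt_self] at this
  exact this

/-- The flat derivative of a vector field which is constant in a chart is the second derivative
of the immersion in that chart. -/
theorem flatDerivative_eq_fderiv {ι : M → EuclideanSpace ℝ (Fin (n + 1))}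
    (hι : ContMDiff (𝓡 n) (𝓡 (n + 1)) ∞ ι) {p : M} {w : EuclideanSpace ℝ (Fin n)}
    {Y : ∀ q : M, TangentSpace (𝓡 n) q}
    (hY : ∀ᶠ q in 𝓝 p,
      mfderiv (𝓡 n) 𝓘(ℝ, EuclideanSpace ℝ (Fin n)) (extChartAt (𝓡 n) p) q (Y q) = w)
    (v : EuclideanSpace ℝ (Fin n)) :
    flatDerivative ι Y p v =
      fderiv ℝ (fderiv ℝ (ι ∘ (extChartAt (𝓡 n) p).symm)) (extChartAt (𝓡 n) p p) v w := by
  set ψ := extChartAt (𝓡 n) p with hψ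
  set F : EuclideanSpace ℝ (Fin n) → EuclideanSpace ℝ (Fin (n + 1)) := ι ∘ ψ.symm with hFdef
  have hT : IsOpen ψ.target := isOpen_extChartAt_target p
  have hpT : ψ p ∈ ψ.target := mem_extChartAt_target p
  have hF : ContDiffOn ℝ ∞ F ψ.target :=
    (hι.comp_contMDiffOn (contMDiffOn_extChartAt_symm p)).contDiffOn
  have hFat : ∀ u ∈ ψ.target, ContDiffAt ℝ ∞ F u := fun u hu => hF.contDiffAt (hT.mem_nhds hu)
  let K : EuclideanSpace ℝ (Fin n) → EuclideanSpace ℝ (Fin (n + 1)) := fun u => fderiv ℝ F u w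
  have hDF : DifferentiableAt ℝ (fderiv ℝ F) (ψ p) :=
    ((hFat _ hpT).fderiv_right (m := ∞) (by simp)).differentiableAt (by simp)
  have hK : HasFDerivAt K ((fderiv ℝ (fderiv ℝ F) (ψ p)).flip w) (ψ p) := by
    have := hDF.hasFDerivAt.clm_apply (hasFDerivAt_const w (ψ p))
    simpa using this
  have hsrc : ∀ᶠ q in 𝓝 p, q ∈ ψ.source := extChartAt_source_mem_nhds p
  have heq : (fun q => hypersurfaceDifferential ι q (Y q)) =ᶠ[𝓝 p] K ∘ ψ := by
    filter_upwards [hY, hsrc] with q hq hqs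
    have h1 : ι =ᶠ[𝓝 q] F ∘ ψ := by
      filter_upwards [(isOpen_extChartAt_source p).mem_nhds hqs] with x hx
      simp only [hFdef, Function.comp_apply]
      rw [ψ.left_inv hx]
    have h2 : MDifferentiableAt (𝓡 n) 𝓘(ℝ, EuclideanSpace ℝ (Fin n)) ψ q :=
      mdifferentiableAt_extChartAt (by rwa [← extChartAt_source (𝓡 n)])
    have h3 : MDifferentiableAt 𝓘(ℝ, EuclideanSpace ℝ (Fin n)) (𝓡 (n + 1)) F (ψ q) :=
      ((hFat _ (ψ.map_source hqs)).differentiableAt (by simp)).mdifferentiableAt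
    have h4 : hypersurfaceDifferential ι q (Y q) =
        mfderiv (𝓡 n) (𝓡 (n + 1)) (F ∘ ψ) q (Y q) := by
      unfold hypersurfaceDifferential
      rw [h1.mfderiv_eq]
      rfl
    rw [h4, mfderiv_comp q h3 h2, mfderiv_eq_fderiv]
    exact congrArg (fderiv ℝ F (ψ q)) hq
  have hmd : MDifferentiableAt (𝓡 n) (𝓡 (n + 1))
      (fun q => hypersurfaceDifferential ι q (Y q)) p :=
    (MDifferentiableAt.comp p (I' := 𝓘(ℝ, EuclideanSpace ℝ (Fin n))) (g := K)
      hK.differentiableAt.mdifferentiableAt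
      (mdifferentiableAt_extChartAt (mem_chart_source _ p))).congr_of_eventuallyEq heq
  have h5 : (fun q => hypersurfaceDifferential ι q (Y q)) ∘ ψ.symm =ᶠ[𝓝 (ψ p)] K := by
    have h6 : ContinuousAt ψ.symm (ψ p) := continuousAt_extChartAt_symm p
    have h7 : Tendsto ψ.symm (𝓝 (ψ p)) (𝓝 p) := by
      have := h6.tendsto
      rwa [extChartAt_to_inv p] at this
    filter_upwards [h7.eventually heq, hT.mem_nhds hpT] with u hu huT
    simp only [Function.comp_apply] at hu ⊢
    rw [hu, ψ.right_inv huT]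
  unfold flatDerivative
  rw [hypersurfaceDifferential_eq_fderiv hmd, h5.fderiv_eq, hK.fderiv]
  rfl

variable {ι : M → EuclideanSpace ℝ (Fin (n + 1))} {X : ℝ → M} {t₀ : ℝ}

/-- The Gauss equation along a curve. -/
theorem exists_deriv_deriv_comp_eq [T2Space M]
    {g : ∀ p : M, TangentSpace (𝓡 n) p →L[ℝ] TangentSpace (𝓡 n) p →L[ℝ] ℝ}
    (hι : ContMDiff (𝓡 n) (𝓡 (n + 1)) ∞ ι) (hg : IsCentroaffineMetric ι g)
    (hX : ContMDiffAt 𝓘(ℝ, ℝ) (𝓡 n) ∞ X t₀) :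
    ∃ u : TangentSpace (𝓡 n) (X t₀), deriv (deriv (ι ∘ X)) t₀ =
      hypersurfaceDifferential ι (X t₀) u +
        g (X t₀) (mfderiv 𝓘(ℝ, ℝ) (𝓡 n) X t₀ 1) (mfderiv 𝓘(ℝ, ℝ) (𝓡 n) X t₀ 1) • ι (X t₀) := by
  set p := X t₀ with hp
  set ψ := extChartAt (𝓡 n) p with hψ
  set F : EuclideanSpace ℝ (Fin n) → EuclideanSpace ℝ (Fin (n + 1)) := ι ∘ ψ.symm with hFdef
  have hT : IsOpen ψ.target := isOpen_extChartAt_target p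
  have hpT : ψ p ∈ ψ.target := mem_extChartAt_target p
  have hF : ContDiffOn ℝ ∞ F ψ.target :=
    (hι.comp_contMDiffOn (contMDiffOn_extChartAt_symm p)).contDiffOn
  have hFat : ∀ u ∈ ψ.target, ContDiffAt ℝ ∞ F u := fun u hu => hF.contDiffAt (hT.mem_nhds hu)
  let ξ : ℝ → EuclideanSpace ℝ (Fin n) := ψ ∘ X
  have hξ : ContDiffAt ℝ ∞ ξ t₀ :=
    ((contMDiffAt_extChartAt (x := p)).comp t₀ hX).contDiffAt
  have hw : mfderiv 𝓘(ℝ, ℝ) (𝓡 n) X t₀ 1 = deriv ξ t₀ := by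
    have h1 : deriv ξ t₀ = mfderiv 𝓘(ℝ, ℝ) 𝓘(ℝ, EuclideanSpace ℝ (Fin n)) (ψ ∘ X) t₀ 1 := by
      rw [mfderiv_eq_fderiv]
      exact fderiv_apply_one_eq_deriv.symm
    rw [h1, mfderiv_comp t₀ (mdifferentiableAt_extChartAt (mem_chart_source _ p))
      (hX.mdifferentiableAt (by simp)), mfderiv_extChartAt_self]
    rfl
  set w : EuclideanSpace ℝ (Fin n) := deriv ξ t₀ with hwdef
  have hev : ∀ᶠ t in 𝓝 t₀, X t ∈ ψ.source :=
    hX.continuousAt.eventually_mem (extChartAt_source_mem_nhds p)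
  have hevT : ∀ᶠ t in 𝓝 t₀, ξ t ∈ ψ.target := hev.mono fun t ht => ψ.map_source ht
  have heq : ι ∘ X =ᶠ[𝓝 t₀] F ∘ ξ := hev.mono fun t ht => by
    simp only [hFdef, ξ, Function.comp_apply]
    rw [ψ.left_inv ht]
  have hξd : ∀ᶠ t in 𝓝 t₀, DifferentiableAt ℝ ξ t :=
    ((hξ.of_le (m := 1) (by simp)).eventually (by simp)).mono fun t ht =>
      ht.differentiableAt (by simp)
  have hd1 : deriv (ι ∘ X) =ᶠ[𝓝 t₀] fun t => fderiv ℝ F (ξ t) (deriv ξ t) := by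
    refine heq.deriv.trans ?_
    filter_upwards [hevT, hξd] with t ht htd
    exact (((hFat _ ht).differentiableAt (by simp)).hasFDerivAt.comp_hasDerivAt t
      htd.hasDerivAt).deriv
  have hDF : DifferentiableAt ℝ (fderiv ℝ F) (ξ t₀) :=
    ((hFat _ hpT).fderiv_right (m := ∞) (by simp)).differentiableAt (by simp)
  have hξ2 : DifferentiableAt ℝ (deriv ξ) t₀ :=
    (hξ.derivWithin (m := ∞) (by simp)).differentiableAt (by simp)
  have hd2 : deriv (deriv (ι ∘ X)) t₀ =
      fderiv ℝ (fderiv ℝ F) (ξ t₀) w w + fderiv ℝ F (ξ t₀) (deriv (deriv ξ) t₀) := by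
    rw [hd1.deriv_eq]
    exact ((hDF.hasFDerivAt.comp_hasDerivAt t₀ hξd.self_of_nhds.hasDerivAt).clm_apply
      hξ2.hasDerivAt).deriv
  -- The Gauss equation speaks of global fields, so the velocity `w` is extended to a field constant
  -- in the chart near `p`. It decomposes `D²F(w, w)`; the remaining term `DF(ξ'')` is tangent and
  -- is absorbed into `u`.
  obtain ⟨Y, hY, hYp, hYe⟩ := exists_smoothVectorField_const p w
  obtain ⟨u, hu⟩ := hg Y hY p w
  rw [flatDerivative_eq_fderiv hι hYe, hYp] at hu
  have hdi := hypersurfaceDifferential_eq_fderiv (p := p) (hι.mdifferentiableAt (by simp))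
  refine ⟨u + (show TangentSpace (𝓡 n) p from deriv (deriv ξ) t₀), ?_⟩
  have h8 : hypersurfaceDifferential ι p (show TangentSpace (𝓡 n) p from deriv (deriv ξ) t₀) =
      fderiv ℝ F (ξ t₀) (deriv (deriv ξ) t₀) := by
    rw [hdi]
    rfl
  rw [hd2, hw, map_add, h8]
  have h9 : fderiv ℝ (fderiv ℝ F) (ξ t₀) w w = _ := hu
  rw [h9]
  abel

/-- In a hyperbolic centroaffine hypersurface, the radial coordinate is concave along lines. -/
theorem deriv_deriv_nonpos_of_smul_eq_line [T2Space M]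
    (hι : ContMDiff (𝓡 n) (𝓡 (n + 1)) ∞ ι) (hcent : IsCentroaffine ι) (hhyp : IsHyperbolic ι)
    (hX : ContMDiffAt 𝓘(ℝ, ℝ) (𝓡 n) ∞ X t₀) {H : ℝ → ℝ} (hH : ContDiffAt ℝ ∞ H t₀)
    (hpos : 0 < H t₀) {a v : EuclideanSpace ℝ (Fin (n + 1))}
    (hline : ∀ᶠ t in 𝓝 t₀, H t • ι (X t) = a + t • v) :
    deriv (deriv H) t₀ ≤ 0 := by
  obtain ⟨g, hg, hgpos⟩ := hhyp
  set p := X t₀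
  set w := mfderiv 𝓘(ℝ, ℝ) (𝓡 n) X t₀ 1
  have hgw : 0 ≤ g p w w := by
    by_cases hw : w = 0
    · simp [hw]
    · exact (hgpos p w hw).le
  have hy : ContDiffAt ℝ ∞ (ι ∘ X) t₀ := (hι.contMDiffAt.comp t₀ hX).contDiffAt
  have hy1 : deriv (ι ∘ X) t₀ = hypersurfaceDifferential ι p w :=
    deriv_comp_eq_hypersurfaceDifferential (hι.mdifferentiableAt (by simp))
      (hX.mdifferentiableAt (by simp))
  obtain ⟨u, hu⟩ := exists_deriv_deriv_comp_eq hι hg hX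
  have hHd : ∀ᶠ t in 𝓝 t₀, DifferentiableAt ℝ H t :=
    ((hH.of_le (m := 1) (by simp)).eventually (by simp)).mono fun t ht =>
      ht.differentiableAt (by simp)
  have hyd : ∀ᶠ t in 𝓝 t₀, DifferentiableAt ℝ (ι ∘ X) t :=
    ((hy.of_le (m := 1) (by simp)).eventually (by simp)).mono fun t ht =>
      ht.differentiableAt (by simp)
  have hH2 : DifferentiableAt ℝ (deriv H) t₀ := (hH.derivWithin (m := ∞) (by simp)).differentiableAt (by simp)
  have hy2 : DifferentiableAt ℝ (deriv (ι ∘ X)) t₀ :=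
    (hy.derivWithin (m := ∞) (by simp)).differentiableAt (by simp)
  have h1 : (fun t => H t • deriv (ι ∘ X) t + deriv H t • (ι ∘ X) t) =ᶠ[𝓝 t₀] fun _ => v := by
    have h2 : ∀ᶠ t in 𝓝 t₀, (fun t => H t • (ι ∘ X) t) =ᶠ[𝓝 t] fun t => a + t • v :=
      hline.eventually_nhds
    filter_upwards [h2, hHd, hyd] with t ht hHt hyt
    have h3 := (hHt.hasDerivAt.smul hyt.hasDerivAt).deriv
    have h4 : deriv (fun t : ℝ => a + t • v) t = v := by
      simpa using (((hasDerivAt_id t).smul_const v).const_add a).deriv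
    rw [← h4, ← ht.deriv_eq]
    exact h3.symm
  have h5 : deriv (fun t => H t • deriv (ι ∘ X) t + deriv H t • (ι ∘ X) t) t₀ =
      (H t₀ • deriv (deriv (ι ∘ X)) t₀ + deriv H t₀ • deriv (ι ∘ X) t₀) +
        (deriv H t₀ • deriv (ι ∘ X) t₀ + deriv (deriv H) t₀ • ι p) :=
    ((hHd.self_of_nhds.hasDerivAt.smul hy2.hasDerivAt).add
      (hH2.hasDerivAt.smul hyd.self_of_nhds.hasDerivAt)).deriv
  rw [h1.deriv_eq, deriv_const, hu, hy1] at h5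
  -- The total coefficient of `ι p` in the second derivative of the line, which is zero. All other
  -- terms are tangent, so a nonzero `c` would make `ι p` tangent.
  set c := deriv (deriv H) t₀ + H t₀ * g p w w with hc
  have h6 : c = 0 := by
    by_contra hne
    refine hcent p ⟨-c⁻¹ • (H t₀ • u + (2 * deriv H t₀) • w), ?_⟩
    simp only [map_smul, map_add]
    have h7 : c • ι p = -(H t₀ • hypersurfaceDifferential ι p u +
        (2 * deriv H t₀) • hypersurfaceDifferential ι p w) := by
      rw [hc, eq_neg_iff_add_eq_zero, h5]
      module
    rw [neg_smul, ← smul_neg, ← h7, inv_smul_smul₀ hne]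
  have := mul_nonneg hpos.le hgw
  linarith

end GaussEquation

/-! ### The induced distance: topology, length bounds, completeness -/

section InducedDistance

open Set Filter Topology MeasureTheory

variable {n : ℕ} {M : Type*} [TopologicalSpace M] [ChartedSpace (EuclideanSpace ℝ (Fin n)) M]

/-- The length of tangent vectors induced by `ι`. -/
noncomputable abbrev inducedENorm (ι : M → EuclideanSpace ℝ (Fin (n + 1))) (p : M) :
    ENorm (TangentSpace (𝓡 n) p) :=
  ⟨fun v => ‖hypersurfaceDifferential ι p v‖ₑ⟩

theorem enormSMulClass_inducedENorm (ι : M → EuclideanSpace ℝ (Fin (n + 1))) (p : M) :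
    letI := inducedENorm ι p
    ENormSMulClass ℝ (TangentSpace (𝓡 n) p) :=
  letI := inducedENorm ι p
  ⟨fun r v => by
    change ‖hypersurfaceDifferential ι p (r • v)‖ₑ = ‖r‖ₑ * ‖hypersurfaceDifferential ι p v‖ₑ
    rw [map_smul, enorm_smul]⟩

variable {ι : M → EuclideanSpace ℝ (Fin (n + 1))}

theorem inducedEDist_comm (x y : M) : inducedEDist ι x y = inducedEDist ι y x :=
  letI := inducedENorm ι
  haveI := enormSMulClass_inducedENorm ι
  Manifold.riemannianEDist_comm

theorem inducedEDist_triangle (x y z : M) :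
    inducedEDist ι x z ≤ inducedEDist ι x y + inducedEDist ι y z :=
  letI := inducedENorm ι
  haveI := enormSMulClass_inducedENorm ι
  Manifold.riemannianEDist_triangle

theorem hypersurfaceDifferential_mfderiv_eq_deriv
    (hι : ContMDiff (𝓡 n) (𝓡 (n + 1)) ∞ ι) {γ : ℝ → M} {a b : ℝ}
    (hγ : ContMDiffOn 𝓘(ℝ, ℝ) (𝓡 n) 1 γ (Icc a b)) {t : ℝ} (ht : t ∈ Ioo a b) :
    hypersurfaceDifferential ι (γ t) (mfderiv 𝓘(ℝ, ℝ) (𝓡 n) γ t 1) = deriv (ι ∘ γ) t :=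
  (deriv_comp_eq_hypersurfaceDifferential (hι.mdifferentiableAt (by simp))
    (((hγ t ⟨ht.1.le, ht.2.le⟩).contMDiffAt
      (Icc_mem_nhds ht.1 ht.2)).mdifferentiableAt (by simp))).symm

/-- Points at small induced distance are joined by paths with small image. -/
theorem exists_path_of_inducedEDist_lt (hι : ContMDiff (𝓡 n) (𝓡 (n + 1)) ∞ ι) {x y : M}
    {δ : ℝ≥0∞} (h : inducedEDist ι x y < δ) :
    ∃ γ : ℝ → M, ContinuousOn γ (Icc 0 1) ∧ γ 0 = x ∧ γ 1 = y ∧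
      ∀ t ∈ Icc (0 : ℝ) 1, edist (ι x) (ι (γ t)) < δ := by
  let := inducedENorm ι
  obtain ⟨γ, hγ0, hγ1, hγ, hlen⟩ := Manifold.exists_lt_of_riemannianEDist_lt (I := 𝓡 n) h
  refine ⟨γ, hγ.continuousOn, hγ0, hγ1, fun t ht => lt_of_le_of_lt ?_ hlen⟩
  have hc : ContDiffOn ℝ 1 (ι ∘ γ) (Icc 0 t) :=
    (((hι.of_le (by simp)).comp_contMDiffOn hγ).mono (Icc_subset_Icc_right ht.2)).contDiffOn
  have h1 := enorm_sub_le_lintegral_deriv_of_contDiffOn_Icc hc ht.1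
  rw [edist_comm, edist_eq_enorm_sub, ← hγ0]
  refine h1.trans ((lintegral_mono_set (Icc_subset_Icc_right ht.2)).trans ?_)
  rw [Manifold.pathELength_eq_lintegral_mfderiv_Ioo, ← restrict_Ioo_eq_restrict_Icc]
  refine (setLIntegral_congr_fun measurableSet_Ioo fun s hs => ?_).le
  change ‖deriv (ι ∘ γ) s‖ₑ = ‖hypersurfaceDifferential ι (γ s) _‖ₑ
  rw [hypersurfaceDifferential_mfderiv_eq_deriv hι hγ hs]

/-- The induced distance of an injective immersion is finer than the manifold topology. -/
theorem exists_forall_inducedEDist_lt_mem [T2Space M] (hι : ContMDiff (𝓡 n) (𝓡 (n + 1)) ∞ ι)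
    (hinj : Function.Injective ι) {x : M} {U : Set M} (hU : U ∈ 𝓝 x) :
    ∃ δ > 0, ∀ y, inducedEDist ι x y < δ → y ∈ U := by
  have : LocallyCompactSpace M :=
    ChartedSpace.locallyCompactSpace (EuclideanSpace ℝ (Fin n)) M
  obtain ⟨K, hK, hKU, hKc⟩ := local_compact_nhds hU
  have hC : IsCompact (K \ interior K) := hKc.diff isOpen_interior
  have hnot : ι x ∉ ι '' (K \ interior K) := by
    rintro ⟨z, hz, hzx⟩
    rw [hinj hzx] at hz
    exact hz.2 (mem_interior_iff_mem_nhds.2 hK)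
  -- A path leaving `K` must meet `K \ interior K`, whose image has positive distance from `ι x` by
  -- compactness and injectivity; a shorter path stays inside.
  refine ⟨Metric.infEDist (ι x) (ι '' (K \ interior K)), ?_, fun y hy => hKU ?_⟩
  · rw [gt_iff_lt, pos_iff_ne_zero]
    intro h0
    exact hnot ((Metric.mem_iff_infEDist_zero_of_closed (hC.image hι.continuous).isClosed).2 h0)
  · obtain ⟨γ, hγ, hγ0, hγ1, hγd⟩ := exists_path_of_inducedEDist_lt hι hy
    have hsub : γ '' Icc 0 1 ⊆ interior K := by
      refine (isPreconnected_Icc.image γ hγ).subset_left_of_subset_union isOpen_interior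
        hKc.isClosed.isOpen_compl (disjoint_compl_right.mono_left interior_subset) ?_
        ⟨x, ⟨0, by simp, hγ0⟩, mem_interior_iff_mem_nhds.2 hK⟩
      rintro _ ⟨t, ht, rfl⟩
      by_contra hcon
      simp only [mem_union, mem_compl_iff, not_or, not_not] at hcon
      exact absurd (hγd t ht) (not_lt.2
        (Metric.infEDist_le_edist_of_mem (mem_image_of_mem ι ⟨hcon.2, hcon.1⟩)))
    exact interior_subset (hsub ⟨1, by simp, hγ1⟩)

theorem tendsto_nhds_of_tendsto_inducedEDist [T2Space M]
    (hι : ContMDiff (𝓡 n) (𝓡 (n + 1)) ∞ ι) (hinj : Function.Injective ι) {α : Type*}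
    {l : Filter α} {X : α → M} {x : M}
    (h : Tendsto (fun t => inducedEDist ι (X t) x) l (𝓝 0)) : Tendsto X l (𝓝 x) := by
  refine tendsto_def.2 fun U hU => ?_
  obtain ⟨δ, hδ, hδU⟩ := exists_forall_inducedEDist_lt_mem hι hinj hU
  filter_upwards [Tendsto.eventually_lt_const (f := fun t => inducedEDist ι (X t) x) hδ h] with t ht
  exact hδU _ (by rwa [inducedEDist_comm])

/-- A bound on the speed of a path bounds the induced distance of its end points. -/
theorem inducedEDist_le_of_norm_deriv_le (hι : ContMDiff (𝓡 n) (𝓡 (n + 1)) ∞ ι) {X : ℝ → M}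
    {s t : ℝ} (hst : s ≤ t) (hX : ContMDiffOn 𝓘(ℝ, ℝ) (𝓡 n) 1 X (Icc s t)) {f f' : ℝ → ℝ}
    (hf : ∀ τ ∈ Icc s t, HasDerivAt f (f' τ) τ)
    (hle : ∀ τ ∈ Icc s t, ‖deriv (ι ∘ X) τ‖ ≤ f' τ) :
    inducedEDist ι (X s) (X t) ≤ ENNReal.ofReal (f t - f s) := by
  let := inducedENorm ι
  have := enormSMulClass_inducedENorm ι
  have hc : ContinuousOn f (Icc s t) := fun τ hτ => (hf τ hτ).continuousAt.continuousWithinAt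
  have hpos : ∀ τ ∈ Icc s t, 0 ≤ f' τ := fun τ hτ => (norm_nonneg _).trans (hle τ hτ)
  -- No continuity of `f'` is assumed: nonnegativity of a derivative suffices for integrability.
  have hint : IntegrableOn f' (Ioc s t) :=
    intervalIntegral.integrableOn_deriv_of_nonneg hc (fun τ hτ => hf τ (Ioo_subset_Icc_self hτ))
      fun τ hτ => hpos τ (Ioo_subset_Icc_self hτ)
  have hFTC : ∫ τ in Ioc s t, f' τ = f t - f s := by
    rw [← intervalIntegral.integral_of_le hst]
    exact intervalIntegral.integral_eq_sub_of_hasDerivAt_of_le hst hc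
      (fun τ hτ => hf τ (Ioo_subset_Icc_self hτ))
      ((intervalIntegrable_iff_integrableOn_Ioc_of_le hst).2 hint)
  refine (Manifold.riemannianEDist_le_pathELength hX rfl rfl hst).trans ?_
  rw [← hFTC, ofReal_integral_eq_lintegral_ofReal hint
    ((ae_restrict_iff' measurableSet_Ioc).2 (ae_of_all _ fun τ hτ =>
      hpos τ (Ioc_subset_Icc_self hτ))),
    Manifold.pathELength_eq_lintegral_mfderiv_Ioo, ← Measure.restrict_congr_set Ioo_ae_eq_Ioc]
  refine setLIntegral_mono' measurableSet_Ioo fun τ hτ => ?_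
  change ‖hypersurfaceDifferential ι (X τ) _‖ₑ ≤ _
  rw [hypersurfaceDifferential_mfderiv_eq_deriv hι hX hτ, ← ofReal_norm]
  exact ENNReal.ofReal_le_ofReal (hle τ (Ioo_subset_Icc_self hτ))

theorem MonotoneOn.exists_tendsto_nhdsLT {f : ℝ → ℝ} {a b : ℝ} (hab : a < b)
    (hf : MonotoneOn f (Ico a b)) {C : ℝ} (hC : ∀ t ∈ Ico a b, f t ≤ C) :
    ∃ L, Tendsto f (𝓝[<] b) (𝓝 L) ∧ ∀ t ∈ Ico a b, f t ≤ L := by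
  have hbdd : BddAbove (f '' Ico a b) := ⟨C, by rintro _ ⟨t, ht, rfl⟩; exact hC t ht⟩
  have hle : ∀ t ∈ Ico a b, f t ≤ sSup (f '' Ico a b) := fun t ht =>
    le_csSup hbdd (mem_image_of_mem f ht)
  refine ⟨sSup (f '' Ico a b), tendsto_order.2 ⟨fun l hl => ?_, fun l hl => ?_⟩, hle⟩
  · obtain ⟨_, ⟨s, hs, rfl⟩, hls⟩ := exists_lt_of_lt_csSup (((nonempty_Ico.2 hab).image f)) hl
    filter_upwards [Ico_mem_nhdsLT hs.2] with t ht
    exact hls.trans_le (hf hs ⟨hs.1.trans ht.1, ht.2⟩ ht.1)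
  · filter_upwards [Ico_mem_nhdsLT hab] with t ht
    exact (hle t ht).trans_lt hl

/-- In a Euclidean complete hypersurface, curves of finite length converge. -/
theorem exists_tendsto_of_inducedEDist_le [T2Space M] (hι : ContMDiff (𝓡 n) (𝓡 (n + 1)) ∞ ι)
    (hinj : Function.Injective ι) (hcomp : IsEuclideanComplete ι) {X : ℝ → M} {f : ℝ → ℝ}
    {a b L : ℝ} (hab : a < b) (hf : Tendsto f (𝓝[<] b) (𝓝 L)) (hfL : ∀ t ∈ Ico a b, f t ≤ L)
    (hX : ∀ s ∈ Ico a b, ∀ t ∈ Ico a b, s ≤ t →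
      inducedEDist ι (X s) (X t) ≤ ENNReal.ofReal (f t - f s)) :
    ∃ x, Tendsto X (𝓝[<] b) (𝓝 x) := by
  have hX' : ∀ s ∈ Ico a b, ∀ t ∈ Ico a b, s ≤ t →
      inducedEDist ι (X s) (X t) ≤ ENNReal.ofReal (L - f s) := fun s hs t ht hst =>
    (hX s hs t ht hst).trans (ENNReal.ofReal_le_ofReal (by linarith [hfL t ht]))
  have hlim : Tendsto (fun t => ENNReal.ofReal (L - f t)) (𝓝[<] b) (𝓝 0) := by
    have := ENNReal.tendsto_ofReal (hf.const_sub L)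
    simpa using this
  -- Completeness is stated for sequences, so `X` is sampled along `u`; the tail bound `L - f t`
  -- then carries the limit over to the whole curve.
  obtain ⟨u, hu, hub, hut⟩ := exists_seq_strictMono_tendsto' hab
  have hu' : ∀ k, u k ∈ Ico a b := fun k => Ioo_subset_Ico_self (hub k)
  have hut' : Tendsto u atTop (𝓝[<] b) :=
    tendsto_nhdsWithin_iff.2 ⟨hut, Eventually.of_forall fun k => (hub k).2⟩
  obtain ⟨x, hx⟩ := hcomp (X ∘ u) fun ε hε => by
    obtain ⟨N, hN⟩ := eventually_atTop.1 ((hlim.comp hut').eventually_lt_const hε)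
    have key : ∀ i ≥ N, ∀ j ≥ i, inducedEDist ι ((X ∘ u) i) ((X ∘ u) j) < ε :=
      fun i hi j hj => (hX' _ (hu' i) _ (hu' j) (hu.monotone hj)).trans_lt (hN i hi)
    refine ⟨N, fun i hi j hj => ?_⟩
    rcases le_total i j with hij | hij
    · exact key i hi j hij
    · rw [inducedEDist_comm]
      exact key j hj i hij
  refine ⟨x, tendsto_nhds_of_tendsto_inducedEDist hι hinj ?_⟩
  refine tendsto_of_tendsto_of_tendsto_of_le_of_le' tendsto_const_nhds hlim
    (Eventually.of_forall fun _ => zero_le) ?_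
  filter_upwards [Ico_mem_nhdsLT hab] with t ht
  have h1 : Tendsto (fun k => ENNReal.ofReal (L - f t) + inducedEDist ι ((X ∘ u) k) x) atTop
      (𝓝 (ENNReal.ofReal (L - f t) + 0)) := hx.const_add _
  rw [add_zero] at h1
  refine ge_of_tendsto h1 ?_
  filter_upwards [hut.eventually_const_le ht.2] with k hk
  exact (inducedEDist_triangle _ (X (u k)) _).trans (add_le_add_left (hX' t ht _ (hu' k) hk) _)

end InducedDistance

/-! ### Lifts of lines through the cone map -/

section Lifts

open Set Filter Topology

/-- Continuous lifts of lines through a local diffeomorphism are smooth. -/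
theorem contMDiffAt_lift_of_isLocalDiffeomorph
    {E E' H N : Type*} [NormedAddCommGroup E] [NormedSpace ℝ E] [TopologicalSpace H]
    [NormedAddCommGroup E'] [NormedSpace ℝ E'] {I : ModelWithCorners ℝ E' H} [TopologicalSpace N]
    [ChartedSpace H N] {φ : N → E} (hφ : IsLocalDiffeomorph I 𝓘(ℝ, E) ∞ φ) {a v : E} {σ : ℝ → N}
    {t₀ : ℝ} (hσ : ContinuousAt σ t₀) (hlift : ∀ᶠ t in 𝓝 t₀, φ (σ t) = a + t • v) :
    ContMDiffAt 𝓘(ℝ, ℝ) I ∞ σ t₀ := by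
  have h1 : (fun t : ℝ => (hφ (σ t₀)).localInverse (a + t • v)) =ᶠ[𝓝 t₀] σ := by
    filter_upwards [hlift, hσ.eventually (hφ (σ t₀)).localInverse_eventuallyEq_left] with t ht ht'
    rw [← ht]
    exact ht'
  refine ContMDiffAt.congr_of_eventuallyEq ?_ h1.symm
  have h2 : ContMDiffAt 𝓘(ℝ, ℝ) 𝓘(ℝ, E) ∞ (fun t : ℝ => a + t • v) t₀ :=
    ContDiffAt.contMDiffAt (by fun_prop)
  refine ContMDiffAt.comp (g := (hφ (σ t₀)).localInverse) t₀ ?_ h2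
  rw [← hlift.self_of_nhds]
  exact (hφ (σ t₀)).localInverse_contMDiffAt

variable {n : ℕ} {M : Type*} [TopologicalSpace M] [ChartedSpace (EuclideanSpace ℝ (Fin n)) M]

theorem contMDiffAt_radial {σ : ℝ → positiveReals × M} {t₀ : ℝ}
    (hσ : ContMDiffAt 𝓘(ℝ, ℝ) (𝓘(ℝ, ℝ).prod (𝓡 n)) ∞ σ t₀) :
    ContDiffAt ℝ ∞ (fun t => ((σ t).1 : ℝ)) t₀ := by
  have h : ContMDiffAt (𝓘(ℝ, ℝ).prod (𝓡 n)) 𝓘(ℝ, ℝ) ∞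
      (fun p : positiveReals × M => (p.1 : ℝ)) (σ t₀) :=
    (contMDiff_subtype_val.comp contMDiff_fst).contMDiffAt
  exact (h.comp t₀ hσ).contDiffAt

variable [IsManifold (𝓡 n) ∞ M] {ι : M → EuclideanSpace ℝ (Fin (n + 1))}
  {a v : EuclideanSpace ℝ (Fin (n + 1))}

theorem deriv_deriv_radial_nonpos [T2Space M]
    (himm : Manifold.IsImmersion (𝓡 n) (𝓡 (n + 1)) ∞ ι) (hcent : IsCentroaffine ι)
    (hhyp : IsHyperbolic ι) {σ : ℝ → positiveReals × M} {t₀ : ℝ}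
    (hσ : ContinuousAt σ t₀) (hlift : ∀ᶠ t in 𝓝 t₀, coneMap ι (σ t) = a + t • v) :
    deriv (deriv fun t => ((σ t).1 : ℝ)) t₀ ≤ 0 := by
  have h := contMDiffAt_lift_of_isLocalDiffeomorph (isLocalDiffeomorph_coneMap himm hcent) hσ hlift
  exact deriv_deriv_nonpos_of_smul_eq_line (X := fun t => (σ t).2) himm.contMDiff hcent hhyp
    (contMDiffAt_snd.comp t₀ h) (contMDiffAt_radial h) (σ t₀).1.2 hlift

theorem concaveAlongLifts_radial [T2Space M]
    (himm : Manifold.IsImmersion (𝓡 n) (𝓡 (n + 1)) ∞ ι) (hcent : IsCentroaffine ι)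
    (hhyp : IsHyperbolic ι) :
    ConcaveAlongLifts (coneMap ι) (fun p : positiveReals × M => (p.1 : ℝ)) := by
  intro a v σ hσ hlift
  have hnhds : ∀ t ∈ Ioo (0 : ℝ) 1, Icc (0 : ℝ) 1 ∈ 𝓝 t := fun t ht => Icc_mem_nhds ht.1 ht.2
  have hsm : ∀ t ∈ Ioo (0 : ℝ) 1, ContDiffAt ℝ ∞ (fun t => ((σ t).1 : ℝ)) t := fun t ht =>
    contMDiffAt_radial (contMDiffAt_lift_of_isLocalDiffeomorph
      (isLocalDiffeomorph_coneMap himm hcent) (hσ.continuousAt (hnhds t ht))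
      (eventually_of_mem (hnhds t ht) hlift))
  refine concaveOn_of_deriv2_nonpos (convex_Icc 0 1)
    ((continuous_subtype_val.comp continuous_fst).comp_continuousOn hσ) ?_ ?_ ?_ <;>
    rw [interior_Icc] <;> intro t ht
  · exact ((hsm t ht).differentiableAt (by simp)).differentiableWithinAt
  · exact (((hsm t ht).derivWithin (m := ∞) (by simp)).differentiableAt
      (by simp)).differentiableWithinAt
  · exact deriv_deriv_radial_nonpos himm hcent hhyp (hσ.continuousAt (hnhds t ht))
      (eventually_of_mem (hnhds t ht) hlift)

/-- The velocity of the projection to `ι(M)` of a lift of a line. -/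
theorem norm_deriv_le_of_smul_eq_line {F : Type*} [NormedAddCommGroup F] [NormedSpace ℝ F]
    {a v : F} {y : ℝ → F} {H : ℝ → ℝ} {t m R : ℝ} (hH : DifferentiableAt ℝ H t) (hm : 0 < m)
    (hmH : m ≤ H t) (hR : ‖a + t • v‖ ≤ R) (hline : ∀ᶠ τ in 𝓝 t, H τ • y τ = a + τ • v) :
    ‖deriv y t‖ ≤ ‖v‖ / m + R / m ^ 2 * |deriv H t| := by
  have hH0 : 0 < H t := hm.trans_le hmH
  have heq : y =ᶠ[𝓝 t] fun τ => (H τ)⁻¹ • (a + τ • v) := by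
    filter_upwards [hline, hH.continuousAt.eventually_ne hH0.ne'] with τ hτ hτ'
    rw [← hτ, inv_smul_smul₀ hτ']
  have hl : HasDerivAt (fun τ : ℝ => a + τ • v) v t := by
    simpa using ((hasDerivAt_id t).smul_const v).const_add a
  have hd := (hH.hasDerivAt.inv hH0.ne').smul hl
  rw [heq.deriv_eq]
  have hd' : deriv (fun τ => (H τ)⁻¹ • (a + τ • v)) t =
      (H t)⁻¹ • v + (-deriv H t / H t ^ 2) • (a + t • v) := hd.deriv
  rw [hd']
  have hR0 : 0 ≤ R := (norm_nonneg _).trans hR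
  refine (norm_add_le _ _).trans (add_le_add ?_ ?_)
  · rw [norm_smul, norm_inv, Real.norm_of_nonneg hH0.le, ← div_eq_inv_mul]
    gcongr
  · rw [norm_smul, norm_div, norm_neg, norm_pow, Real.norm_of_nonneg hH0.le, Real.norm_eq_abs]
    calc |deriv H t| / H t ^ 2 * ‖a + t • v‖ ≤ |deriv H t| / m ^ 2 * R := by gcongr
      _ = R / m ^ 2 * |deriv H t| := by ring

/-- The projected speed is at most `A + B * |H'|`. As `H'` is antitone, `H' ≤ K` from the midpoint
on, so `|H'| ≤ 2 * K - H'`. This majorant has an explicit primitive, bounded above because `H > 0`,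
so the projected curve has finite length. -/
theorem liftsConverge_radial [T2Space M]
    (himm : Manifold.IsImmersion (𝓡 n) (𝓡 (n + 1)) ∞ ι) (hinj : Function.Injective ι)
    (hcent : IsCentroaffine ι) (hhyp : IsHyperbolic ι) (hcomp : IsEuclideanComplete ι) :
    LiftsConverge (coneMap ι) (fun p : positiveReals × M => (p.1 : ℝ)) := by
  intro a v T σ m hT hσ hlift hm hmσ
  have hι := himm.contMDiff
  have hIoo : ∀ t ∈ Ioo 0 T, Ico 0 T ∈ 𝓝 t := fun t ht => Ico_mem_nhds ht.1 ht.2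
  have hev : ∀ t ∈ Ioo 0 T, ∀ᶠ τ in 𝓝 t, coneMap ι (σ τ) = a + τ • v := fun t ht =>
    eventually_of_mem (hIoo t ht) hlift
  have hsm : ∀ t ∈ Ioo 0 T, ContMDiffAt 𝓘(ℝ, ℝ) (𝓘(ℝ, ℝ).prod (𝓡 n)) ∞ σ t := fun t ht =>
    contMDiffAt_lift_of_isLocalDiffeomorph
      (isLocalDiffeomorph_coneMap himm hcent) (hσ.continuousAt (hIoo t ht)) (hev t ht)
  let H : ℝ → ℝ := fun t => ((σ t).1 : ℝ)
  let X : ℝ → M := fun t => (σ t).2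
  have hH : ∀ t ∈ Ioo 0 T, ContDiffAt ℝ ∞ H t := fun t ht => contMDiffAt_radial (hsm t ht)
  have hX : ∀ t ∈ Ioo 0 T, ContMDiffAt 𝓘(ℝ, ℝ) (𝓡 n) ∞ X t := fun t ht =>
    contMDiffAt_snd.comp t (hsm t ht)
  have hHd : ∀ t ∈ Ioo 0 T, HasDerivAt H (deriv H t) t := fun t ht =>
    ((hH t ht).differentiableAt (by simp)).hasDerivAt
  have hH2 : ∀ t ∈ Ioo 0 T, DifferentiableAt ℝ (deriv H) t := fun t ht =>
    ((hH t ht).derivWithin (m := ∞) (by simp)).differentiableAt (by simp)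
  have hanti : AntitoneOn (deriv H) (Ioo 0 T) := by
    refine antitoneOn_of_deriv_nonpos (convex_Ioo 0 T)
      (fun t ht => (hH2 t ht).continuousAt.continuousWithinAt) ?_ ?_ <;>
      rw [interior_Ioo] <;> intro t ht
    · exact (hH2 t ht).differentiableWithinAt
    · exact deriv_deriv_radial_nonpos himm hcent hhyp (hσ.continuousAt (hIoo t ht)) (hev t ht)
  -- The midpoint, because smoothness of the lift is only available on the open interval and `H'`
  -- need not be bounded near `0`.
  let K := |deriv H (T / 2)|
  let R := ‖a‖ + T * ‖v‖ + 1
  have hR : 0 < R := by positivity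
  let A := ‖v‖ / m
  let B := R / m ^ 2
  have hB : 0 < B := by positivity
  have hA : 0 ≤ A := by positivity
  have hK : 0 ≤ K := abs_nonneg _
  have hT2 : T / 2 < T := by linarith
  have hmem : ∀ t ∈ Ico (T / 2) T, t ∈ Ioo 0 T := fun t ht => ⟨by linarith [ht.1], ht.2⟩
  let f : ℝ → ℝ := fun t => A * t + B * (2 * K * t - H t)
  let f' : ℝ → ℝ := fun t => A + B * (2 * K - deriv H t)
  have hf : ∀ t ∈ Ico (T / 2) T, HasDerivAt f (f' t) t := fun t ht => by
    have h1 : HasDerivAt (fun t : ℝ => A * t) A t := by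
      simpa using (hasDerivAt_id t).const_mul A
    have h2 : HasDerivAt (fun t : ℝ => 2 * K * t) (2 * K) t := by
      simpa using (hasDerivAt_id t).const_mul (2 * K)
    exact h1.add ((h2.sub (hHd t (hmem t ht))).const_mul B)
  have hspeed : ∀ t ∈ Ico (T / 2) T, ‖deriv (ι ∘ X) t‖ ≤ f' t := fun t ht => by
    have ht' := hmem t ht
    have hRt : ‖a + t • v‖ ≤ R := by
      refine (norm_add_le _ _).trans ?_
      rw [norm_smul, Real.norm_of_nonneg ht'.1.le]
      have := mul_le_mul_of_nonneg_right ht'.2.le (norm_nonneg v)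
      simp only [R]
      linarith
    have h1 := norm_deriv_le_of_smul_eq_line (y := ι ∘ X) (hHd t ht').differentiableAt hm
      (hmσ t ⟨ht'.1.le, ht'.2⟩) hRt (hev t ht')
    have h2 : deriv H t ≤ K :=
      (hanti (hmem _ ⟨le_rfl, hT2⟩) ht' ht.1).trans (le_abs_self _)
    have h3 : |deriv H t| ≤ 2 * K - deriv H t := by
      rw [abs_le]
      constructor <;> linarith
    exact h1.trans (add_le_add_right (mul_le_mul_of_nonneg_left h3 hB.le) _)
  have hf0 : ∀ t ∈ Ico (T / 2) T, 0 ≤ f' t := fun t ht => (norm_nonneg _).trans (hspeed t ht)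
  have hmono : MonotoneOn f (Ico (T / 2) T) := by
    refine monotoneOn_of_deriv_nonneg (convex_Ico _ _)
      (fun t ht => (hf t ht).continuousAt.continuousWithinAt)
      (fun t ht => (hf t (interior_subset ht)).differentiableAt.differentiableWithinAt)
      fun t ht => ?_
    rw [(hf t (interior_subset ht)).deriv]
    exact hf0 t (interior_subset ht)
  have hbound : ∀ t ∈ Ico (T / 2) T, f t ≤ A * T + B * (2 * K * T) := fun t ht => by
    have hHt : 0 < H t := (σ t).1.2
    have h1 : A * t ≤ A * T := by gcongr; exact ht.2.le
    have h2 : 2 * K * t ≤ 2 * K * T := by gcongr; exact ht.2.le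
    have h3 : B * (2 * K * t - H t) ≤ B * (2 * K * T) := by gcongr; linarith
    exact add_le_add h1 h3
  obtain ⟨L, hL, hfL⟩ := hmono.exists_tendsto_nhdsLT hT2 hbound
  obtain ⟨x, hx⟩ := exists_tendsto_of_inducedEDist_le (X := X) hι hinj hcomp hT2 hL hfL
    fun s hs t ht hst => by
      have hsub : Icc s t ⊆ Ico (T / 2) T := fun τ hτ => ⟨hs.1.trans hτ.1, hτ.2.trans_lt ht.2⟩
      exact inducedEDist_le_of_norm_deriv_le hι hst
        (fun τ hτ => ((hX τ (hmem τ (hsub hτ))).of_le (by simp)).contMDiffWithinAt)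
        (fun τ hτ => hf τ (hsub hτ)) fun τ hτ => hspeed τ (hsub hτ)
  -- `H` is recovered by solving the definition of `f` for it, which uses `B ≠ 0`; this is why `R`
  -- carries the summand `1`. The bound `m` keeps the limit positive.
  have hHlim : Tendsto H (𝓝[<] T) (𝓝 (2 * K * T - (L - A * T) / B)) := by
    have hid : Tendsto (fun t : ℝ => t) (𝓝[<] T) (𝓝 T) := tendsto_id.mono_left nhdsWithin_le_nhds
    have h1 := (hid.const_mul (2 * K)).sub ((hL.sub (hid.const_mul A)).div_const B)
    refine h1.congr fun t => ?_
    simp only [f]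
    field_simp
    ring
  have hmlim : m ≤ 2 * K * T - (L - A * T) / B := by
    refine ge_of_tendsto hHlim ?_
    filter_upwards [Ico_mem_nhdsLT hT] with t ht using hmσ t ht
  refine ⟨(⟨_, hm.trans_le hmlim⟩, x), ?_⟩
  exact Tendsto.prodMk_nhds (tendsto_subtype_rng.2 hHlim) hx

end Lifts

/-! ### From injective local diffeomorphism to diffeomorphism, and the conclusion -/

section Main

open Set Filter Topology

/-- An injective local diffeomorphism is a diffeomorphism onto its image. -/
theorem exists_diffeomorph_opens_of_injective
    {E F H H' N P : Type*} [NormedAddCommGroup E] [NormedSpace ℝ E] [NormedAddCommGroup F]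
    [NormedSpace ℝ F] [TopologicalSpace H] [TopologicalSpace H']
    {I : ModelWithCorners ℝ E H} {J : ModelWithCorners ℝ F H'}
    [TopologicalSpace N] [ChartedSpace H N] [TopologicalSpace P] [ChartedSpace H' P]
    [IsManifold J ∞ P] {φ : N → P} (hφ : IsLocalDiffeomorph I J ∞ φ)
    (hinj : Function.Injective φ) (U : TopologicalSpace.Opens P) (hU : (U : Set P) = range φ) :
    ∃ Φ : Diffeomorph I J N U ∞, ∀ p, (Φ p : P) = φ p := by
  have hmem : ∀ p, φ p ∈ U := fun p => by
    rw [← SetLike.mem_coe, hU]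
    exact mem_range_self p
  let e : N ≃ U := Equiv.ofBijective (fun p => ⟨φ p, hmem p⟩)
    ⟨fun p q h => hinj (congrArg Subtype.val h), fun z => by
      obtain ⟨p, hp⟩ : (z : P) ∈ range φ := hU ▸ z.2
      exact ⟨p, Subtype.ext hp⟩⟩
  have hto : ContMDiff I J ∞ e :=
    (ContMDiff.iff_comp_isImmersion (Manifold.IsImmersion.of_opens U)).2
      ⟨hφ.contMDiff.continuous.subtype_mk hmem, hφ.contMDiff⟩
  have hinv : ContMDiff J I ∞ e.symm := fun z => by
    obtain ⟨p, rfl⟩ := e.surjective z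
    have h1 : ContMDiffAt J I ∞ (fun z : U => (hφ p).localInverse (z : P)) (e p) :=
      ContMDiffAt.comp (g := (hφ p).localInverse) (e p) (hφ p).localInverse_contMDiffAt
        contMDiff_subtype_val.contMDiffAt
    refine h1.congr_of_eventuallyEq ?_
    have h2 : ∀ᶠ z : U in 𝓝 (e p), φ ((hφ p).localInverse (z : P)) = z :=
      (continuous_subtype_val.tendsto (e p)).eventually
        (hφ p).localInverse_eventuallyEq_right
    filter_upwards [h2] with z hz
    rw [Equiv.symm_apply_eq]
    exact Subtype.ext hz.symm
  exact ⟨⟨e, hto, hinv⟩, fun p => rfl⟩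

end Main

theorem proposition1p7 {n : ℕ} {M : Type*} [TopologicalSpace M]
    [ChartedSpace (EuclideanSpace ℝ (Fin n)) M] [IsManifold (𝓡 n) ∞ M] [ConnectedSpace M]
    (ι : M → EuclideanSpace ℝ (Fin (n + 1)))
    (hinj : Function.Injective ι)
    (himm : Manifold.IsImmersion (𝓡 n) (𝓡 (n + 1)) ∞ ι)
    (hcent : IsCentroaffine ι)
    (hhyp : IsHyperbolic ι)
    (hcomp : IsEuclideanComplete ι) :
    ∃ hU : IsOpen (positiveCone ι),
      Convex ℝ (positiveCone ι) ∧
      ∃ Φ : Diffeomorph (𝓘(ℝ, ℝ).prod (𝓡 n)) (𝓡 (n + 1))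
          (positiveReals × M)
          (⟨positiveCone ι, hU⟩ : TopologicalSpace.Opens (EuclideanSpace ℝ (Fin (n + 1)))) ∞,
        ∀ (r : positiveReals) (x : M),
          (Φ (r, x) : EuclideanSpace ℝ (Fin (n + 1))) = (r : ℝ) • ι x := by
  -- Separation is not assumed of `M`; it is pulled back from Euclidean space.
  have hT2 : T2Space M := T2Space.of_injective_continuous hinj himm.contMDiff.continuous
  have hφ := isLocalDiffeomorph_coneMap himm hcent
  have hpre : PreconnectedSpace positiveReals :=
    Subtype.preconnectedSpace (convex_Ioi (0 : ℝ)).isPreconnected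
  have hvis : ∀ p q : positiveReals × M, Visible (coneMap ι) p q :=
    visible_of_concaveAlongLifts hφ.isLocalHomeomorph
      (continuous_subtype_val.comp continuous_fst) (fun p => p.1.2)
      (concaveAlongLifts_radial himm hcent hhyp)
      (liftsConverge_radial himm hinj hcent hhyp hcomp)
  have hU : IsOpen (positiveCone ι) := range_coneMap ι ▸ hφ.isOpen_range
  obtain ⟨Φ, hΦ⟩ := exists_diffeomorph_opens_of_injective hφ (injective_of_visible hvis)
    ⟨positiveCone ι, hU⟩ (range_coneMap ι).symm
  exact ⟨hU, range_coneMap ι ▸ convex_range_of_visible hvis, Φ, fun r x => hΦ (r, x)⟩
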